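/- Let $\Gamma$ be a dense additive subgroup of $\mathbb{R}$ with $1\in\Gamma$. Let $\mathbb{R}_\Gamma$ be the set obtained from $\mathbb{R}$ by replacing each $a\in\Gamma$ by two points $a_-<a_+$, with the resulting total order (if $q:\mathbb{R}_\Gamma\to\mathbb{R}$ is the quotient map, then $x<y$ whenever $q(x)<q(y)$) and the order topology. The discrete group $\Gamma$ acts on $\mathbb{R}_\Gamma$ by translation: $c+a_\pm=(c+a)_\pm$ for $a\in\Gamma$, and $c+t$ is the usual sum for $t\notin\Gamma$. Let $\mathcal{G}_\Gamma$ be the restriction of the transformation groupoid $\Gamma\ltimes\mathbb{R}_\Gamma$ to the compact open set $[0_+,1_-]$, that is $$\mathcal{G}_\Gamma=\{(c,x)\in\Gamma\times\mathbb{R}_\Gamma : x\in[0_+,1_-],\ c+x\in[0_+,1_-]\},$$ with source $x$, range $c+x$ and product $(c,d+x)(d,x)=(c+d,x)$. For a Hausdorff étale groupoid $\mathcal{G}$ let $\mathcal{G}^{(0)}$ be its unit space and $\mathcal{G}^{(n)}$ the space of composable strings $(g_1,\dots,g_n)$, with face maps $d_0,\dots,d_n:\mathcal{G}^{(n)}\to\mathcal{G}^{(n-1)}$,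 where $d_0$ drops $g_1$, $d_n$ drops $g_n$, $d_i$ replaces $g_i,g_{i+1}$ by $g_ig_{i+1}$ for $0<i<n$ (for $n=1$: $d_0$ is the source and $d_1$ the range). The groupoid homology $H_k(\mathcal{G})$ is the homology of the complex of groups $C_c(\mathcal{G}^{(n)},\mathbb{Z})$ of compactly supported continuous functions with differential $\sum_{i=0}^n(-1)^i(d_i)_*$ (and zero differential on $C_c(\mathcal{G}^{(0)},\mathbb{Z})$), where $(\pi_*f)(y)=\sum_{\pi(x)=y}f(x)$ for a local homeomorphism $\pi$. Then for every $k\ge 0$ there is an isomorphism of abelian groups $$H_k(\mathcal{G}_\Gamma)\cong H_{k+1}(\Gamma),$$ where $H_{k+1}(\Gamma)=H_{k+1}(\Gamma,\mathbb{Z})$ is group homology with trivial integer coefficients. In particular $H_0(\mathcal{G}_\Gamma)\cong\Gamma$. -/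

import Mathlib

open Topology CategoryTheory
open scoped CompactlySupported

namespace GroupoidHomology

section Pushforward

variable {X Y Z : Type} [TopologicalSpace X] [TopologicalSpace Y] [T2Space Y]
  [TopologicalSpace Z] [T2Space Z]

/-- A compactly supported function meets each fibre of a local homeomorphism in a finite set. -/
theorem finite_fiber_inter_tsupport {f : X → Y} (hf : IsLocalHomeomorph f) (φ : C_c(X, ℤ)) (y : Y) :
    (f ⁻¹' {y} ∩ tsupport φ).Finite := by
  have hc : IsCompact (f ⁻¹' {y} ∩ tsupport φ) :=
    φ.hasCompactSupport.isCompact.inter_left (isClosed_singleton.preimage hf.continuous)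
  refine hc.finite ?_
  refine (hf.isLocalHomeomorphOn.mono (Set.subset_univ _)).isDiscrete_of_image ?_
  have : (f '' (f ⁻¹' {y} ∩ tsupport φ)).Subsingleton := by
    rintro _ ⟨a, ⟨ha, -⟩, rfl⟩ _ ⟨b, ⟨hb, -⟩, rfl⟩
    exact ha.trans hb.symm
  exact this.isDiscrete

theorem finite_fiber_support {f : X → Y} (hf : IsLocalHomeomorph f) (φ : C_c(X, ℤ)) (y : Y) :
    (f ⁻¹' {y} ∩ Function.support φ).Finite :=
  (finite_fiber_inter_tsupport hf φ y).subset
    (Set.inter_subset_inter_right _ (subset_tsupport φ))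

variable [T2Space X]

theorem continuous_fiberSum {f : X → Y} (hf : IsLocalHomeomorph f) (φ : C_c(X, ℤ)) :
    Continuous fun y => ∑ᶠ x ∈ f ⁻¹' {y}, φ x := by
  rw [continuous_iff_continuousAt]
  intro y₀
  obtain ⟨T, hT⟩ := (finite_fiber_inter_tsupport hf φ y₀).exists_finset_coe
  obtain ⟨U, hU, hdisj⟩ := T.finite_toSet.t2_separation
  have hV : ∀ x : X, ∃ V : Set X, x ∈ V ∧ IsOpen V ∧ V ⊆ U x ∧ V.InjOn f ∧
      ∀ x' ∈ V, φ x' = φ x := by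
    intro x
    obtain ⟨W, hWo, hxW, hW⟩ := hf.isLocallyInjective x
    refine ⟨U x ∩ W ∩ φ ⁻¹' {φ x}, ⟨⟨(hU x).1, hxW⟩, rfl⟩,
      ((hU x).2.inter hWo).inter ((isOpen_discrete _).preimage φ.continuous),
      fun a h => h.1.1, ?_, fun a h => h.2⟩
    intro a ha b hb hab
    exact hW ha.1.2 hb.1.2 hab
  choose V hxV hVo hVU hVinj hVφ using hV
  have hC : IsCompact (tsupport φ \ ⋃ x ∈ T, V x) :=
    φ.hasCompactSupport.isCompact.diff (isOpen_biUnion fun x _ => hVo x)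
  have hfC : IsClosed (f '' (tsupport φ \ ⋃ x ∈ T, V x)) := (hC.image hf.continuous).isClosed
  have hN1 : (f '' (tsupport φ \ ⋃ x ∈ T, V x))ᶜ ∈ 𝓝 y₀ := by
    refine hfC.isOpen_compl.mem_nhds ?_
    rintro ⟨x, ⟨hx, hx'⟩, hxy⟩
    have : x ∈ T := by rw [← Finset.mem_coe, hT]; exact ⟨hxy, hx⟩
    exact hx' (Set.mem_biUnion this (hxV x))
  have hN2 : (⋂ x ∈ T, f '' V x) ∈ 𝓝 y₀ := by
    rw [Filter.biInter_finset_mem]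
    intro x hx
    rw [← Finset.mem_coe, hT] at hx
    exact (hf.isOpenMap _ (hVo x)).mem_nhds ⟨x, hxV x, hx.1⟩
  have key : ∀ y ∈ (⋂ x ∈ T, f '' V x) ∩ (f '' (tsupport φ \ ⋃ x ∈ T, V x))ᶜ,
      ∑ᶠ x ∈ f ⁻¹' {y}, φ x = ∑ᶠ x ∈ (T : Set X), φ x := by
    rintro y ⟨hy1, hy2⟩
    have hs : ∀ x, ∃ x', x ∈ T → x' ∈ V x ∧ f x' = y := by
      intro x
      by_cases hx : x ∈ T
      · obtain ⟨x', h1, h2⟩ := Set.mem_iInter₂.1 hy1 x hx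
        exact ⟨x', fun _ => ⟨h1, h2⟩⟩
      · exact ⟨x, fun h => (hx h).elim⟩
    choose s hs using hs
    have hbij : Set.BijOn s (T : Set X) (s '' T) := by
      refine Set.InjOn.bijOn_image ?_
      intro a ha b hb hab
      by_contra hne
      have := hdisj ha hb hne
      refine Set.disjoint_left.1 this (hVU a (hs a ha).1) ?_
      rw [hab]
      exact hVU b (hs b hb).1
    rw [finsum_mem_eq_of_bijOn (g := φ) s hbij (fun x hx => (hVφ x _ (hs x hx).1).symm)]
    refine finsum_mem_inter_support_eq' _ _ _ ?_
    intro x hx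
    constructor
    · intro hxy
      by_contra hn
      refine hy2 ⟨x, ⟨subset_tsupport _ hx, ?_⟩, hxy⟩
      intro hmem
      obtain ⟨t, ht, hxt⟩ := Set.mem_iUnion₂.1 hmem
      exact hn ⟨t, ht, hVinj t (hs t ht).1 hxt ((hs t ht).2.trans (Eq.symm hxy))⟩
    · rintro ⟨t, ht, rfl⟩
      exact (hs t ht).2
  have hev : (fun y => ∑ᶠ x ∈ f ⁻¹' {y}, φ x) =ᶠ[𝓝 y₀] fun _ => ∑ᶠ x ∈ (T : Set X), φ x :=
    Filter.eventually_of_mem (Filter.inter_mem hN2 hN1) key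
  exact hev.continuousAt

/-- The push-forward `f_* : C_c(X, ℤ) → C_c(Y, ℤ)` along a local homeomorphism `f : X → Y`,
`f_* φ (y) = ∑_{f x = y} φ x` (the sum has finitely many non-zero terms). -/
noncomputable def pushforward (f : X → Y) (hf : IsLocalHomeomorph f) :
    C_c(X, ℤ) →ₗ[ℤ] C_c(Y, ℤ) where
  toFun φ :=
    { toFun := fun y => ∑ᶠ x ∈ f ⁻¹' {y}, φ x
      continuous_toFun := continuous_fiberSum hf φ
      hasCompactSupport' := by
        refine HasCompactSupport.intro (φ.hasCompactSupport.isCompact.image hf.continuous) ?_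
        intro y hy
        refine finsum_mem_eq_zero_of_forall_eq_zero ?_
        intro x hx
        by_contra hne
        exact hy ⟨x, subset_tsupport _ hne, hx⟩ }
  map_add' φ ψ := by
    ext y
    exact finsum_mem_add_distrib' (finite_fiber_support hf φ y) (finite_fiber_support hf ψ y)
  map_smul' c φ := by
    ext y
    exact ((AddMonoidHom.mulLeft c).map_finsum_mem' (finite_fiber_support hf φ y)).symm

theorem pushforward_apply (f : X → Y) (hf : IsLocalHomeomorph f) (φ : C_c(X, ℤ)) (y : Y) :
    pushforward f hf φ y = ∑ᶠ x ∈ f ⁻¹' {y}, φ x := rfl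

theorem pushforward_id (hf : IsLocalHomeomorph (id : X → X)) :
    pushforward id hf = LinearMap.id := by
  ext φ x
  rw [pushforward_apply]
  simp

theorem pushforward_comp (g : Y → Z) (hg : IsLocalHomeomorph g) (f : X → Y)
    (hf : IsLocalHomeomorph f) (hgf : IsLocalHomeomorph (g ∘ f)) :
    pushforward (g ∘ f) hgf = pushforward g hg ∘ₗ pushforward f hf := by
  classical
  ext φ z
  rw [LinearMap.comp_apply, pushforward_apply, pushforward_apply]
  obtain ⟨S, hS⟩ := (finite_fiber_support hgf φ z).exists_finset_coe
  have hS' : ∀ x, x ∈ S ↔ g (f x) = z ∧ φ x ≠ 0 := fun x => by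
    rw [← Finset.mem_coe, hS]; rfl
  have h1 : ∑ᶠ x ∈ (g ∘ f) ⁻¹' {z}, φ x = ∑ x ∈ S, φ x := by
    refine finsum_mem_eq_sum_of_inter_support_eq _ ?_
    rw [hS, Set.inter_assoc, Set.inter_self]
  have h2 : ∀ y ∈ g ⁻¹' {z}, pushforward f hf φ y = ∑ x ∈ S with f x = y, φ x := by
    intro y hy
    refine finsum_mem_eq_sum_of_inter_support_eq _ ?_
    ext x
    simp only [Finset.coe_filter, hS', Set.mem_inter_iff, Set.mem_preimage, Set.mem_singleton_iff,
      Function.mem_support, Set.mem_ofPred_eq]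
    constructor
    · rintro ⟨rfl, h⟩
      exact ⟨⟨⟨hy, h⟩, rfl⟩, h⟩
    · rintro ⟨⟨_, h⟩, _⟩
      exact ⟨h, ‹_›⟩
  have h3 : ∑ᶠ y ∈ g ⁻¹' {z}, pushforward f hf φ y =
      ∑ y ∈ S.image f, ∑ x ∈ S with f x = y, φ x := by
    rw [finsum_mem_congr rfl h2]
    refine finsum_mem_eq_sum_of_inter_support_eq _ ?_
    ext y
    simp only [Set.mem_inter_iff, Function.mem_support, Set.mem_preimage, Set.mem_singleton_iff,
      Finset.coe_image, Set.mem_image, Finset.mem_coe]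
    constructor
    · rintro ⟨_, h⟩
      refine ⟨?_, h⟩
      obtain ⟨x, hx, _⟩ := Finset.exists_ne_zero_of_sum_ne_zero h
      rw [Finset.mem_filter] at hx
      exact ⟨x, hx⟩
    · rintro ⟨⟨x, hx, rfl⟩, h⟩
      exact ⟨((hS' x).1 hx).1, h⟩
  rw [h1, h3]
  exact (Finset.sum_fiberwise_of_maps_to (fun x hx => Finset.mem_image_of_mem f hx) _).symm

end Pushforward

/-- A topological groupoid with arrow space `G` and unit space `X`. The product `g h` is defined
exactly when the source of `g` is the range of `h`. -/
structure TopologicalGroupoid (G X : Type) [TopologicalSpace G] [TopologicalSpace X] where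
  /-- source -/
  src : G → X
  /-- range -/
  rng : G → X
  /-- inclusion of the unit space -/
  unit : X → G
  /-- inverse -/
  inv : G → G
  /-- partially defined product -/
  mul : (g h : G) → src g = rng h → G
  src_unit : ∀ x, src (unit x) = x
  rng_unit : ∀ x, rng (unit x) = x
  src_inv : ∀ g, src (inv g) = rng g
  rng_inv : ∀ g, rng (inv g) = src g
  src_mul : ∀ g h (e : src g = rng h), src (mul g h e) = src h
  rng_mul : ∀ g h (e : src g = rng h), rng (mul g h e) = rng g
  mul_assoc : ∀ g h k (e : src g = rng h) (e' : src h = rng k),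
    mul (mul g h e) k ((src_mul g h e).trans e') = mul g (mul h k e') (e.trans (rng_mul h k e').symm)
  unit_mul : ∀ g, mul (unit (rng g)) g (src_unit _) = g
  mul_unit : ∀ g, mul g (unit (src g)) (rng_unit _).symm = g
  inv_mul : ∀ g, mul (inv g) g (src_inv g) = unit (src g)
  mul_inv : ∀ g, mul g (inv g) (rng_inv g).symm = unit (rng g)
  continuous_src : Continuous src
  continuous_rng : Continuous rng
  continuous_unit : Continuous unit
  continuous_inv : Continuous inv
  continuous_mul : Continuous fun p : {p : G × G // src p.1 = rng p.2} => mul p.1.1 p.1.2 p.2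

namespace TopologicalGroupoid

variable {G X : Type} [TopologicalSpace G] [TopologicalSpace X] (𝒢 : TopologicalGroupoid G X)

/-- A topological groupoid is étale if its source map is a local homeomorphism. -/
def IsEtale : Prop := IsLocalHomeomorph 𝒢.src

/-- The space `𝒢⁽ⁿ⁾` of `n`-simplices of the nerve of `𝒢`, i.e. of commutative diagrams in `𝒢` on
`n + 1` vertices: an arrow `g i j` from the `j`-th to the `i`-th vertex for all `i`, `j`, with
`g i j * g j k = g i k`, topologised as a subspace of a power of `G`. Such a diagram amounts to the
string of composable arrows `g 0 1, g 1 2, …, g (n - 1) n` (to the unit `g 0 0` if `n = 0`). -/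
abbrev Nerve (n : ℕ) : Type :=
  {g : Fin (n + 1) → Fin (n + 1) → G //
    ∀ i j k, ∃ e : 𝒢.src (g i j) = 𝒢.rng (g j k), 𝒢.mul (g i j) (g j k) e = g i k}

/-- The map `𝒢⁽ⁿ⁾ → 𝒢⁽ᵐ⁾` that selects the vertices `f 0, …, f m`. For the injection
`Fin n → Fin (n + 1)` that misses `i` this is the `i`-th face map: it composes the `i`-th and the
`(i + 1)`-st arrow of a string `g₁, …, gₙ` if `0 < i < n`, drops `g₁` if `i = 0`, and drops `gₙ` if
`i = n` (if `n = 1`, it is the source for `i = 0` and the range for `i = 1`). -/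
def Nerve.reindex {m n : ℕ} (f : Fin (m + 1) → Fin (n + 1)) (g : 𝒢.Nerve n) : 𝒢.Nerve m :=
  ⟨fun i j => g.1 (f i) (f j), fun i j k => g.2 (f i) (f j) (f k)⟩

theorem Nerve.continuous_reindex {m n : ℕ} (f : Fin (m + 1) → Fin (n + 1)) :
    Continuous (Nerve.reindex 𝒢 f) :=
  Continuous.subtype_mk (continuous_pi fun i => continuous_pi fun j =>
    (continuous_apply (f j)).comp ((continuous_apply (f i)).comp continuous_subtype_val))
    fun g => (Nerve.reindex 𝒢 f g).2

/-- The `j`-th vertex of a simplex. -/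
def Nerve.vertex {n : ℕ} (j : Fin (n + 1)) (g : 𝒢.Nerve n) : X := 𝒢.src (g.1 j j)

variable {𝒢}

theorem Nerve.src_eq {n : ℕ} (g : 𝒢.Nerve n) (i j : Fin (n + 1)) :
    𝒢.src (g.1 i j) = 𝒢.src (g.1 j j) :=
  (g.2 i j j).1.trans (g.2 j j j).1.symm

theorem unit_mul' {x : X} {g : G} (e : 𝒢.src (𝒢.unit x) = 𝒢.rng g) : 𝒢.mul (𝒢.unit x) g e = g := by
  obtain rfl : x = 𝒢.rng g := (𝒢.src_unit x).symm.trans e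
  exact 𝒢.unit_mul g

theorem mul_unit' {x : X} {g : G} (e : 𝒢.src g = 𝒢.rng (𝒢.unit x)) : 𝒢.mul g (𝒢.unit x) e = g := by
  obtain rfl : 𝒢.src g = x := e.trans (𝒢.rng_unit x)
  exact 𝒢.mul_unit g

theorem inv_mul_mul {g h : G} (e : 𝒢.src g = 𝒢.rng h) :
    𝒢.mul (𝒢.inv g) (𝒢.mul g h e) ((𝒢.src_inv g).trans (𝒢.rng_mul g h e).symm) = h := by
  rw [← 𝒢.mul_assoc (𝒢.inv g) g h (𝒢.src_inv g) e]
  simp only [𝒢.inv_mul]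
  exact unit_mul' _

theorem mul_inv_mul {a b c : G} (e : 𝒢.src a = 𝒢.src b) (e' : 𝒢.src b = 𝒢.src c) :
    𝒢.mul (𝒢.mul a (𝒢.inv b) (e.trans (𝒢.rng_inv b).symm))
      (𝒢.mul b (𝒢.inv c) (e'.trans (𝒢.rng_inv c).symm))
      ((𝒢.src_mul _ _ _).trans ((𝒢.src_inv b).trans (𝒢.rng_mul _ _ _).symm)) =
    𝒢.mul a (𝒢.inv c) ((e.trans e').trans (𝒢.rng_inv c).symm) := by
  rw [𝒢.mul_assoc a (𝒢.inv b) _ (e.trans (𝒢.rng_inv b).symm)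
    ((𝒢.src_inv b).trans (𝒢.rng_mul _ _ _).symm)]
  simp only [inv_mul_mul]

theorem Nerve.diag {n : ℕ} (g : 𝒢.Nerve n) (j : Fin (n + 1)) :
    g.1 j j = 𝒢.unit (𝒢.src (g.1 j j)) := by
  obtain ⟨e, h⟩ := g.2 j j j
  have h1 := inv_mul_mul e
  simp only [h] at h1
  exact h1.symm.trans (𝒢.inv_mul _)

theorem Nerve.eq_mul_inv {n : ℕ} (g : 𝒢.Nerve n) (i j k : Fin (n + 1)) :
    ∃ e : 𝒢.src (g.1 i j) = 𝒢.rng (𝒢.inv (g.1 k j)),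
      𝒢.mul (g.1 i j) (𝒢.inv (g.1 k j)) e = g.1 i k := by
  obtain ⟨e1, h1⟩ := g.2 i k j
  have e2 : 𝒢.src (g.1 i j) = 𝒢.rng (𝒢.inv (g.1 k j)) := by
    rw [𝒢.rng_inv, g.src_eq i j, g.src_eq k j]
  refine ⟨e2, ?_⟩
  have h2 := 𝒢.mul_assoc (g.1 i k) (g.1 k j) (𝒢.inv (g.1 k j)) e1 (𝒢.rng_inv _).symm
  simp only [h1, 𝒢.mul_inv] at h2
  exact h2.trans (mul_unit' _)

/-- The vertex maps of the nerve of an étale groupoid are local homeomorphisms. -/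
theorem Nerve.isLocalHomeomorph_vertex (h𝒢 : 𝒢.IsEtale) {n : ℕ} (j : Fin (n + 1)) :
    IsLocalHomeomorph (Nerve.vertex 𝒢 j) := by
  classical
  intro g₀
  choose e he he' using fun i => h𝒢 (g₀.1 i j)
  let T : Set X := {x | (∀ i, x ∈ (e i).target) ∧ 𝒢.unit x ∈ (e j).source}
  have hsrc : ∀ x ∈ T, ∀ i, 𝒢.src ((e i).symm x) = x := by
    intro x hx i
    rw [he' i]
    exact (e i).right_inv (hx.1 i)
  have hE : ∀ x ∈ T, ∀ i k, 𝒢.src ((e i).symm x) = 𝒢.src ((e k).symm x) :=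
    fun x hx i k => (hsrc x hx i).trans (hsrc x hx k).symm
  let S : (x : X) → x ∈ T → 𝒢.Nerve n := fun x hx =>
    ⟨fun i k => 𝒢.mul ((e i).symm x) (𝒢.inv ((e k).symm x))
        ((hE x hx i k).trans (𝒢.rng_inv _).symm),
      fun i k l => ⟨(𝒢.src_mul _ _ _).trans ((𝒢.src_inv _).trans (𝒢.rng_mul _ _ _).symm),
        mul_inv_mul (hE x hx i k) (hE x hx k l)⟩⟩
  have hunit : ∀ x ∈ T, (e j).symm x = 𝒢.unit x := by
    intro x hx
    have h1 : e j (𝒢.unit x) = x := by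
      rw [← he' j]; exact 𝒢.src_unit x
    conv_lhs => rw [← h1]
    exact (e j).left_inv hx.2
  have hS : ∀ x (hx : x ∈ T) i, (S x hx).1 i j = (e i).symm x := by
    intro x hx i
    have h1 : 𝒢.inv ((e j).symm x) = 𝒢.unit x := by
      rw [hunit x hx]
      have h2 := unit_mul' (𝒢 := 𝒢) (x := x) (g := 𝒢.inv (𝒢.unit x))
        ((𝒢.src_unit x).trans ((𝒢.rng_inv _).trans (𝒢.src_unit x)).symm)
      rw [← h2, 𝒢.mul_inv, 𝒢.rng_unit]
    show 𝒢.mul _ _ _ = _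
    simp only [h1]
    exact mul_unit' _
  have hvS : ∀ x (hx : x ∈ T), Nerve.vertex 𝒢 j (S x hx) = x := by
    intro x hx
    show 𝒢.src ((S x hx).1 j j) = x
    rw [hS x hx j]
    exact hsrc x hx j
  have hcont : Continuous (Nerve.vertex 𝒢 j) :=
    𝒢.continuous_src.comp ((continuous_apply j).comp
      ((continuous_apply j).comp continuous_subtype_val))
  have hmap : ∀ g : 𝒢.Nerve n, (∀ i, g.1 i j ∈ (e i).source) → Nerve.vertex 𝒢 j g ∈ T := by
    intro g hg
    refine ⟨fun i => ?_, ?_⟩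
    · have : Nerve.vertex 𝒢 j g = e i (g.1 i j) := by
        rw [← he' i]; exact (g.src_eq i j).symm
      rw [this]
      exact (e i).map_source (hg i)
    · have := hg j
      rw [g.diag j] at this
      exact this
  have hleft : ∀ (g : 𝒢.Nerve n) (hg : ∀ i, g.1 i j ∈ (e i).source),
      S _ (hmap g hg) = g := by
    intro g hg
    have h1 : ∀ i, (e i).symm (Nerve.vertex 𝒢 j g) = g.1 i j := by
      intro i
      have : Nerve.vertex 𝒢 j g = e i (g.1 i j) := by
        rw [← he' i]; exact (g.src_eq i j).symm
      rw [this]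
      exact (e i).left_inv (hg i)
    refine Subtype.ext (funext fun i => funext fun k => ?_)
    obtain ⟨e1, h2⟩ := g.eq_mul_inv i j k
    rw [← h2]
    show 𝒢.mul _ _ _ = _
    simp only [h1]
  refine ⟨
    { toFun := Nerve.vertex 𝒢 j
      invFun := fun x => if hx : x ∈ T then S x hx else g₀
      source := {g | ∀ i, g.1 i j ∈ (e i).source}
      target := T
      map_source' := hmap
      map_target' := ?_
      left_inv' := ?_
      right_inv' := ?_
      open_source := ?_
      open_target := ?_
      continuousOn_toFun := hcont.continuousOn
      continuousOn_invFun := ?_ }, fun i => he i, rfl⟩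
  · intro x hx i
    rw [dif_pos hx, hS x hx i]
    exact (e i).map_target (hx.1 i)
  · intro g hg
    rw [dif_pos (hmap g hg)]
    exact hleft g hg
  · intro x hx
    rw [dif_pos hx]
    exact hvS x hx
  · rw [continuousOn_iff_continuous_domRestrict]
    have h1 : T.domRestrict (fun x => if hx : x ∈ T then S x hx else g₀) =
        fun x : T => S x.1 x.2 := by
      ext x
      simp [Set.domRestrict]
    rw [h1]
    have hc : ∀ i, Continuous fun x : T => (e i).symm x.1 := fun i =>
      continuousOn_iff_continuous_domRestrict.1
        ((e i).continuousOn_symm.mono fun x hx => hx.1 i)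
    refine Continuous.subtype_mk (continuous_pi fun i => continuous_pi fun k => ?_) _
    exact 𝒢.continuous_mul.comp
      (Continuous.subtype_mk ((hc i).prodMk (𝒢.continuous_inv.comp (hc k)))
        fun x => (hE x.1 x.2 i k).trans (𝒢.rng_inv _).symm)
  · have : {g : 𝒢.Nerve n | ∀ i, g.1 i j ∈ (e i).source} =
        ⋂ i, (fun g : 𝒢.Nerve n => g.1 i j) ⁻¹' (e i).source := by
      ext g; simp
    rw [this]
    refine isOpen_iInter_of_finite fun i => (e i).open_source.preimage ?_
    exact (continuous_apply j).comp ((continuous_apply i).comp continuous_subtype_val)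
  · have : T = (⋂ i, (e i).target) ∩ 𝒢.unit ⁻¹' (e j).source := by
      ext x; simp [T]
    rw [this]
    exact (isOpen_iInter_of_finite fun i => (e i).open_target).inter
      ((e j).open_source.preimage 𝒢.continuous_unit)

theorem Nerve.isLocalHomeomorph_reindex (h𝒢 : 𝒢.IsEtale) {m n : ℕ}
    (f : Fin (m + 1) → Fin (n + 1)) : IsLocalHomeomorph (Nerve.reindex 𝒢 f) :=
  IsLocalHomeomorph.of_comp (g := Nerve.vertex 𝒢 0)
    (Nerve.isLocalHomeomorph_vertex h𝒢 (f 0)) (Nerve.isLocalHomeomorph_vertex h𝒢 0)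
    (Nerve.continuous_reindex 𝒢 f)

/-- The simplicial abelian group `n ↦ C_c(𝒢⁽ⁿ⁾, ℤ)` of a Hausdorff étale groupoid, whose structure
maps are the push-forwards along the structure maps of the nerve. -/
noncomputable def simplicialModule [T2Space G] (h𝒢 : 𝒢.IsEtale) :
    SimplicialObject (ModuleCat.{0} ℤ) where
  obj n := ModuleCat.of ℤ C_c(𝒢.Nerve n.unop.len, ℤ)
  map f := ModuleCat.ofHom
    (pushforward (Nerve.reindex 𝒢 f.unop.toOrderHom) (Nerve.isLocalHomeomorph_reindex h𝒢 _))
  map_id n := by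
    ext1
    exact pushforward_id (X := 𝒢.Nerve n.unop.len) (Nerve.isLocalHomeomorph_reindex h𝒢 id)
  map_comp f g := by
    ext1
    exact pushforward_comp (Nerve.reindex 𝒢 g.unop.toOrderHom)
      (Nerve.isLocalHomeomorph_reindex h𝒢 _) (Nerve.reindex 𝒢 f.unop.toOrderHom)
      (Nerve.isLocalHomeomorph_reindex h𝒢 _)
      (Nerve.isLocalHomeomorph_reindex h𝒢 (f ≫ g).unop.toOrderHom)

/-- The chain complex `⋯ → C_c(𝒢⁽²⁾, ℤ) → C_c(𝒢⁽¹⁾, ℤ) → C_c(𝒢⁽⁰⁾, ℤ) → 0` with differential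
`∑ᵢ (-1)ⁱ (dᵢ)_*`, where `dᵢ` are the face maps. -/
noncomputable def chainComplex [T2Space G] (h𝒢 : 𝒢.IsEtale) : ChainComplex (ModuleCat.{0} ℤ) ℕ :=
  (AlgebraicTopology.alternatingFaceMapComplex (ModuleCat.{0} ℤ)).obj (simplicialModule h𝒢)

/-- The groupoid homology `H_k(𝒢)` (with coefficients in `ℤ`) of a Hausdorff étale groupoid. -/
noncomputable def homology [T2Space G] (h𝒢 : 𝒢.IsEtale) (k : ℕ) : ModuleCat.{0} ℤ :=
  (chainComplex h𝒢).homology k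

end TopologicalGroupoid

/-! ### Transformation groupoids restricted to open sets -/

/-- The arrows of the restriction of the transformation groupoid `A ⋉ Z` to `Y ⊆ Z`: pairs `(a, z)`
with `z ∈ Y` and `a + z ∈ Y`. -/
@[ext] structure RestrictedArrow (A : Type) {Z : Type} [AddGroup A] [AddAction A Z]
    [TopologicalSpace Z] (Y : TopologicalSpace.Opens Z) where
  /-- the group element -/
  elt : A
  /-- the point on which it acts -/
  pt : Z
  pt_mem : pt ∈ Y
  vadd_mem : elt +ᵥ pt ∈ Y

namespace RestrictedArrow

variable {A Z : Type} [AddGroup A] [AddAction A Z] [TopologicalSpace Z]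
  {Y : TopologicalSpace.Opens Z}

/-- The subspace topology of the product of the discrete group `A` and the space `Z`. -/
instance : TopologicalSpace (RestrictedArrow A Y) :=
  TopologicalSpace.induced (fun g => (g.elt, g.pt)) (@instTopologicalSpaceProd A Z ⊥ _)

theorem continuous_mk_iff {W : Type} [TopologicalSpace W] {f : W → RestrictedArrow A Y} :
    Continuous f ↔
      Continuous[inferInstance, ⊥] (fun w => (f w).elt) ∧ Continuous fun w => (f w).pt := by
  let _ : TopologicalSpace A := ⊥
  exact continuous_induced_rng.trans continuous_prodMk

theorem continuous_pt : Continuous (pt : RestrictedArrow A Y → Z) :=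
  (continuous_mk_iff.1 continuous_id).2

theorem continuous_elt : Continuous[inferInstance, ⊥] (elt : RestrictedArrow A Y → A) :=
  (continuous_mk_iff.1 continuous_id).1

theorem continuous_snd_pt (p : RestrictedArrow A Y × RestrictedArrow A Y → Prop) :
    Continuous fun w : Subtype p => w.1.2.pt :=
  continuous_pt.comp (continuous_snd.comp continuous_subtype_val)

theorem isOpen_elt_eq (a : A) : IsOpen {g : RestrictedArrow A Y | g.elt = a} := by
  let _ : TopologicalSpace A := ⊥
  have : DiscreteTopology A := ⟨rfl⟩
  exact (isOpen_discrete {a}).preimage continuous_elt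

instance [T2Space Z] : T2Space (RestrictedArrow A Y) := by
  let _ : TopologicalSpace A := ⊥
  have : DiscreteTopology A := ⟨rfl⟩
  refine T2Space.of_injective_continuous (f := fun g : RestrictedArrow A Y => (g.elt, g.pt)) ?_
    (continuous_elt.prodMk continuous_pt)
  intro g h e
  exact RestrictedArrow.ext (congrArg Prod.fst e) (congrArg Prod.snd e)

theorem continuous_vadd [ContinuousConstVAdd A Z] :
    Continuous fun g : RestrictedArrow A Y => g.elt +ᵥ g.pt := by
  rw [continuous_iff_continuousAt]
  intro g
  have h1 : (fun h : RestrictedArrow A Y => h.elt +ᵥ h.pt) =ᶠ[𝓝 g] fun h => g.elt +ᵥ h.pt := by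
    filter_upwards [(isOpen_elt_eq g.elt).mem_nhds rfl] with h hh
    rw [show h.elt = g.elt from hh]
  exact ((continuous_pt.const_vadd g.elt).continuousAt).congr h1.symm

end RestrictedArrow

open RestrictedArrow in
/-- The restriction `A ⋉ Z |_Y^Y` of the transformation groupoid of an action of a discrete group
`A` on `Z` to an open set `Y ⊆ Z`, that is the groupoid of the partial action of `A` on `Y`: it has
unit space `Y`, the arrow `(a, z)` has source `z` and range `a + z`, and
`(a, b + z) (b, z) = (a + b, z)`. -/
def restrictedTransformationGroupoid (A : Type) {Z : Type} [AddGroup A] [AddAction A Z]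
    [TopologicalSpace Z] [ContinuousConstVAdd A Z] (Y : TopologicalSpace.Opens Z) :
    TopologicalGroupoid (RestrictedArrow A Y) Y where
  src g := ⟨g.pt, g.pt_mem⟩
  rng g := ⟨g.elt +ᵥ g.pt, g.vadd_mem⟩
  unit y := ⟨0, y, y.2, by rw [zero_vadd]; exact y.2⟩
  inv g := ⟨-g.elt, g.elt +ᵥ g.pt, g.vadd_mem, by rw [neg_vadd_vadd]; exact g.pt_mem⟩
  mul g h e := ⟨g.elt + h.elt, h.pt, h.pt_mem, by
    rw [add_vadd, ← show g.pt = h.elt +ᵥ h.pt from congrArg Subtype.val e]; exact g.vadd_mem⟩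
  src_unit _ := rfl
  rng_unit y := Subtype.ext (zero_vadd A (y : Z))
  src_inv _ := rfl
  rng_inv g := Subtype.ext (neg_vadd_vadd g.elt g.pt)
  src_mul _ _ _ := rfl
  rng_mul g h e := Subtype.ext <| by
    show (g.elt + h.elt) +ᵥ h.pt = g.elt +ᵥ g.pt
    rw [add_vadd, ← show g.pt = h.elt +ᵥ h.pt from congrArg Subtype.val e]
  mul_assoc g h k _ _ := RestrictedArrow.ext (add_assoc g.elt h.elt k.elt) rfl
  unit_mul g := RestrictedArrow.ext (zero_add g.elt) rfl
  mul_unit g := RestrictedArrow.ext (add_zero g.elt) rfl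
  inv_mul g := RestrictedArrow.ext (neg_add_cancel g.elt) rfl
  mul_inv g := RestrictedArrow.ext (add_neg_cancel g.elt) rfl
  continuous_src := continuous_pt.subtype_mk _
  continuous_rng := continuous_vadd.subtype_mk _
  continuous_unit := continuous_mk_iff.2
    ⟨@continuous_const _ _ _ ⊥ _, continuous_subtype_val⟩
  continuous_inv := continuous_mk_iff.2 ⟨by
    let _ : TopologicalSpace A := ⊥
    have : DiscreteTopology A := ⟨rfl⟩
    exact (continuous_of_discreteTopology (f := fun a : A => -a)).comp continuous_elt,
    continuous_vadd⟩
  continuous_mul := continuous_mk_iff.2 ⟨by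
    let _ : TopologicalSpace A := ⊥
    have : DiscreteTopology A := ⟨rfl⟩
    exact (continuous_of_discreteTopology (f := fun p : A × A => p.1 + p.2)).comp
      ((continuous_elt.comp (continuous_fst.comp continuous_subtype_val)).prodMk
        (continuous_elt.comp (continuous_snd.comp continuous_subtype_val))),
    continuous_snd_pt _⟩

theorem restrictedTransformationGroupoid_isEtale (A : Type) {Z : Type} [AddGroup A] [AddAction A Z]
    [TopologicalSpace Z] [ContinuousConstVAdd A Z] (Y : TopologicalSpace.Opens Z) :
    (restrictedTransformationGroupoid A Y).IsEtale := by
  classical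
  intro g₀
  let S : Y → RestrictedArrow A Y := fun y =>
    if hy : g₀.elt +ᵥ (y : Z) ∈ Y then ⟨g₀.elt, y, y.2, hy⟩ else g₀
  have hS : ∀ (y : Y) (hy : g₀.elt +ᵥ (y : Z) ∈ Y), S y = ⟨g₀.elt, y, y.2, hy⟩ :=
    fun y hy => dif_pos hy
  have hmem : ∀ g : RestrictedArrow A Y, g.elt = g₀.elt → g₀.elt +ᵥ g.pt ∈ Y := by
    intro g hg
    rw [← hg]
    exact g.vadd_mem
  refine ⟨
    { toFun := (restrictedTransformationGroupoid A Y).src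
      invFun := S
      source := {g | g.elt = g₀.elt}
      target := {y | g₀.elt +ᵥ (y : Z) ∈ Y}
      map_source' := hmem
      map_target' := fun y hy => by rw [hS y hy]; rfl
      left_inv' := fun g hg => (hS _ (hmem g hg)).trans (RestrictedArrow.ext (Eq.symm hg) rfl)
      right_inv' := fun y hy => by rw [hS y hy]; rfl
      continuousOn_toFun := (restrictedTransformationGroupoid A Y).continuous_src.continuousOn
      continuousOn_invFun := ?_
      open_source := RestrictedArrow.isOpen_elt_eq _
      open_target := Y.isOpen.preimage (continuous_subtype_val.const_vadd g₀.elt) }, rfl, rfl⟩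
  rw [continuousOn_iff_continuous_domRestrict]
  have h1 : Set.domRestrict {y : Y | g₀.elt +ᵥ (y : Z) ∈ Y} S =
      fun w => ⟨g₀.elt, w.1, w.1.2, w.2⟩ :=
    funext fun w => hS w.1 w.2
  rw [h1]
  exact RestrictedArrow.continuous_mk_iff.2
    ⟨@continuous_const _ _ _ ⊥ _, continuous_subtype_val.comp continuous_subtype_val⟩

/-! ### The line with doubled points and its groupoid -/

/-- The set `ℝ_Γ` obtained from `ℝ` by doubling every point `a ∈ Γ` into `a₋` (`upper = false`) and
`a₊` (`upper = true`); a point `t ∉ Γ` is recorded with `upper = false`. -/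
@[ext] structure SplitLine (Γ : AddSubgroup ℝ) where
  /-- the quotient map `q : ℝ_Γ → ℝ` -/
  val : ℝ
  /-- whether the point is of the form `a₊` -/
  upper : Bool
  mem_of_upper : upper = true → val ∈ Γ

namespace SplitLine

variable {Γ : AddSubgroup ℝ}

/-- The total order on `ℝ_Γ`: `x < y` if `q x < q y`, and `a₋ < a₊` for `a ∈ Γ`. -/
noncomputable instance : LinearOrder (SplitLine Γ) :=
  LinearOrder.lift' (fun x : SplitLine Γ => toLex (x.val, x.upper)) fun x y h => by
    have h' := toLex.injective h
    exact SplitLine.ext (congrArg Prod.fst h') (congrArg Prod.snd h')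

theorem lt_iff {x y : SplitLine Γ} :
    x < y ↔ x.val < y.val ∨ x.val = y.val ∧ x.upper < y.upper :=
  Prod.Lex.toLex_lt_toLex

theorem le_iff {x y : SplitLine Γ} :
    x ≤ y ↔ x.val < y.val ∨ x.val = y.val ∧ x.upper ≤ y.upper :=
  Prod.Lex.toLex_le_toLex

/-- `ℝ_Γ` carries the order topology. -/
noncomputable instance : TopologicalSpace (SplitLine Γ) := Preorder.topology _

instance : OrderTopology (SplitLine Γ) := ⟨rfl⟩

/-- The point `a₊`. -/
def plus (a : Γ) : SplitLine Γ := ⟨a, true, fun _ => a.2⟩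

/-- The point `a₋`. -/
def minus (a : Γ) : SplitLine Γ := ⟨a, false, fun _ => a.2⟩

/-- The action of `Γ` on `ℝ_Γ` by translation: `c + a₊ = (c + a)₊`, `c + a₋ = (c + a)₋`, and `c + t`
is the usual sum for `t ∉ Γ`. -/
noncomputable instance : AddAction Γ (SplitLine Γ) where
  vadd c x := ⟨c + x.val, x.upper, fun h => Γ.add_mem c.2 (x.mem_of_upper h)⟩
  zero_vadd x := SplitLine.ext (zero_add x.val) rfl
  add_vadd c d x := SplitLine.ext (add_assoc (c : ℝ) d x.val) rfl

theorem vadd_le_vadd_iff' (c : Γ) (x y : SplitLine Γ) : c +ᵥ x ≤ c +ᵥ y ↔ x ≤ y := by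
  rw [le_iff, le_iff]
  exact or_congr (add_lt_add_iff_left (c : ℝ)) (and_congr_left' (add_right_inj (c : ℝ)))

instance : ContinuousConstVAdd Γ (SplitLine Γ) where
  continuous_const_vadd c :=
    OrderIso.continuous
      { AddAction.toPerm c with map_rel_iff' := fun {x y} => vadd_le_vadd_iff' c x y }

/-- The compact open interval `[0₊, 1₋]` of `ℝ_Γ`, which is equal to `(0₋, 1₊)`. -/
noncomputable def unitInterval (h1 : (1 : ℝ) ∈ Γ) : TopologicalSpace.Opens (SplitLine Γ) where
  carrier := Set.Icc (plus 0) (minus ⟨1, h1⟩)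
  is_open' := by
    have : Set.Icc (plus 0) (minus ⟨1, h1⟩) = Set.Ioo (minus (0 : Γ)) (plus ⟨1, h1⟩) := by
      ext x
      simp only [Set.mem_Icc, Set.mem_Ioo, le_iff, lt_iff, plus, minus]
      cases x.upper <;> simp [le_iff_lt_or_eq]
    rw [this]
    exact isOpen_Ioo

end SplitLine

end GroupoidHomology

open GroupoidHomology

/-- The groupoid `𝒢_Γ = Γ ⋉ ℝ_Γ |` restricted to `[0₊, 1₋]`, for a subgroup `Γ ∋ 1` of `ℝ`. -/
noncomputable def intervalExchangeGroupoid (Γ : AddSubgroup ℝ) (h1 : (1 : ℝ) ∈ Γ) :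
    TopologicalGroupoid (RestrictedArrow Γ (SplitLine.unitInterval h1))
      (SplitLine.unitInterval h1) :=
  restrictedTransformationGroupoid Γ (SplitLine.unitInterval h1)

theorem intervalExchangeGroupoid_isEtale (Γ : AddSubgroup ℝ) (h1 : (1 : ℝ) ∈ Γ) :
    (intervalExchangeGroupoid Γ h1).IsEtale :=
  restrictedTransformationGroupoid_isEtale Γ _

/-- The group homology `H_n(Γ) = H_n(Γ, ℤ)` with trivial coefficients. -/
noncomputable abbrev integralGroupHomology (Γ : AddSubgroup ℝ) (n : ℕ) : ModuleCat.{0} ℤ :=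
  groupHomology (Rep.trivial ℤ (Multiplicative Γ) ℤ) n

/-! Write `Z` for the line with doubled points and `Y` for its interval `[0₊, 1₋]`. The homology is
computed in three moves.

Passing from `Y` to `Z`. Every point of `Z` has exactly one integer translate in `Y`, and the
integer is locally constant. This gives a functor from `Γ ⋉ Z` to its restriction to `Y`, in the
opposite direction to the inclusion. Any two functors given by piecewise translations are naturally
isomorphic, hence induce homotopic simplicial maps (`translateHomotopy`). So both composites are
homotopic to the identity, and restriction does not change homology (`homologyRestrictIso`).

Passing to group homology. The `n`-simplices of the nerve of `Γ ⋉ Z` form the disjoint union of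
copies of `Z` indexed by `Γⁿ`, so its complex is that of inhomogeneous chains with coefficients in
`C_c(Z, ℤ)` (`inhomogeneousChainsIsoChainComplex`).

Identifying the coefficients. A compactly supported locally constant function on `Z` has finitely
many jumps `φ(a₊) - φ(a₋)`, is determined by them, and they add up to zero; every finite family of
jumps with sum zero occurs. Thus `C_c(Z, ℤ)` is the augmentation ideal of `ℤ[Γ]`, equivariantly
(`jumps_injective`, `augmentation_eq_zero_iff`, `jumps_functionRepresentation`). In the long exact
sequence of `0 → I → ℤ[Γ] → ℤ → 0` the group ring is acyclic in positive degrees and `H₀(I) →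
H₀(ℤ[Γ])` vanishes, so the connecting map `H_{k+1}(Γ, ℤ) → H_k(Γ, I)` is an isomorphism for all `k`
(`isIso_δ_augmentation`). For `k = 0` the target is `H₁(Γ)`, the abelianization of `Γ`, which is
`Γ`. -/

namespace GroupoidHomology

open TopologicalGroupoid TopologicalSpace

/-! ### Piecewise translations and invariance of homology under restriction -/

section Translations

variable {A Z : Type} [AddGroup A] [AddAction A Z] [TopologicalSpace Z]

/-- A piecewise translation from `Y` to `Y'`: a locally constant family of elements of `A` that
moves every point of `Y` into `Y'`. -/
structure PiecewiseTranslation (A : Type) {Z : Type} [AddGroup A] [AddAction A Z]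
    [TopologicalSpace Z] (Y Y' : Opens Z) where
  /-- the group element by which a point is translated -/
  toFun : Y → A
  isLocallyConstant : IsLocallyConstant toFun
  vadd_mem : ∀ y : Y, toFun y +ᵥ (y : Z) ∈ Y'

namespace PiecewiseTranslation

variable {Y Y' Y'' : Opens Z}

/-- The underlying map of spaces. -/
def move (f : PiecewiseTranslation A Y Y') (y : Y) : Y' := ⟨f.toFun y +ᵥ (y : Z), f.vadd_mem y⟩

/-- The inclusion of a smaller open set. -/
def ofLE (A : Type) {Z : Type} [AddGroup A] [AddAction A Z]
    [TopologicalSpace Z] {Y Y' : Opens Z} (h : Y ≤ Y') : PiecewiseTranslation A Y Y' where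
  toFun _ := 0
  isLocallyConstant := IsLocallyConstant.const 0
  vadd_mem y := by rw [zero_vadd]; exact h y.2

variable [ContinuousConstVAdd A Z]

/-- Near a point the translating element is constant, so the map is there the restriction of a
homeomorphism of `Z` to an open set. -/
theorem isLocalHomeomorph_move (f : PiecewiseTranslation A Y Y') : IsLocalHomeomorph f.move := by
  rw [isLocalHomeomorph_iff_isOpenEmbedding_restrict]
  intro y
  have hU : IsOpen {x : Y | f.toFun x = f.toFun y} := f.isLocallyConstant.isOpen_fiber _
  refine ⟨_, hU.mem_nhds rfl, ?_⟩
  refine IsOpenEmbedding.of_comp (g := ((↑) : Y' → Z)) _ Y'.isOpenEmbedding' ?_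
  have h : ((↑) : Y' → Z) ∘ Set.domRestrict {x : Y | f.toFun x = f.toFun y} f.move =
      (fun z : Z => f.toFun y +ᵥ z) ∘ ((↑) : Y → Z) ∘
        ((↑) : {x : Y | f.toFun x = f.toFun y} → Y) := by
    funext x
    exact congrArg (· +ᵥ ((x : Y) : Z)) x.2
  rw [h]
  exact (Homeomorph.vadd (f.toFun y)).isOpenEmbedding.comp
    (Y.isOpenEmbedding'.comp hU.isOpenEmbedding_subtypeVal)

/-- The composition of piecewise translations. -/
def comp (f' : PiecewiseTranslation A Y' Y'') (f : PiecewiseTranslation A Y Y') :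
    PiecewiseTranslation A Y Y'' where
  toFun y := f'.toFun (f.move y) + f.toFun y
  isLocallyConstant :=
    (f'.isLocallyConstant.comp_continuous f.isLocalHomeomorph_move.continuous).add
      f.isLocallyConstant
  vadd_mem y := by rw [add_vadd]; exact f'.vadd_mem (f.move y)

end PiecewiseTranslation

variable [ContinuousConstVAdd A Z] {Y Y' Y'' : Opens Z}

theorem nerve_pt_eq {n : ℕ} (g : (restrictedTransformationGroupoid A Y).Nerve n)
    (i j : Fin (n + 1)) :
    (g.1 i j).pt = ((Nerve.vertex (restrictedTransformationGroupoid A Y) j g : Y) : Z) :=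
  congrArg Subtype.val (g.src_eq i j)

theorem nerve_elt_vadd {n : ℕ} (g : (restrictedTransformationGroupoid A Y).Nerve n)
    (i j : Fin (n + 1)) :
    (g.1 i j).elt +ᵥ ((Nerve.vertex (restrictedTransformationGroupoid A Y) j g : Y) : Z) =
      ((Nerve.vertex (restrictedTransformationGroupoid A Y) i g : Y) : Z) := by
  rw [← nerve_pt_eq g i j, ← nerve_pt_eq g j i]
  exact (congrArg Subtype.val (g.2 j i j).1).symm

theorem nerve_elt_add {n : ℕ} (g : (restrictedTransformationGroupoid A Y).Nerve n)
    (i j k : Fin (n + 1)) : (g.1 i j).elt + (g.1 j k).elt = (g.1 i k).elt := by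
  obtain ⟨e, h⟩ := g.2 i j k
  exact congrArg RestrictedArrow.elt h

theorem nerve_ext {n : ℕ} {g h : (restrictedTransformationGroupoid A Y).Nerve n}
    (he : ∀ i j, (g.1 i j).elt = (h.1 i j).elt)
    (hv : ∀ j, Nerve.vertex _ j g = Nerve.vertex _ j h) : g = h :=
  Subtype.ext <| funext fun i => funext fun j => RestrictedArrow.ext (he i j) <| by
    rw [nerve_pt_eq, nerve_pt_eq, hv]

theorem continuous_vertex {n : ℕ} (j : Fin (n + 1)) :
    Continuous (Nerve.vertex (restrictedTransformationGroupoid A Y) j) :=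
  (Nerve.isLocalHomeomorph_vertex (restrictedTransformationGroupoid_isEtale A Y) j).continuous

/-- The map of nerves that selects the vertices `v 0, …, v m` and moves them by the piecewise
translations `f 0, …, f m`. -/
def translateNerve {m n : ℕ} (v : Fin (m + 1) → Fin (n + 1))
    (f : Fin (m + 1) → PiecewiseTranslation A Y Y')
    (g : (restrictedTransformationGroupoid A Y).Nerve n) :
    (restrictedTransformationGroupoid A Y').Nerve m :=
  ⟨fun i j =>
    ⟨(f i).toFun (Nerve.vertex _ (v i) g) + (g.1 (v i) (v j)).elt +
        -(f j).toFun (Nerve.vertex _ (v j) g),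
      (f j).move (Nerve.vertex _ (v j) g), ((f j).move _).2, by
        change _ +ᵥ ((f j).toFun _ +ᵥ _) ∈ Y'
        rw [add_vadd, neg_vadd_vadd, add_vadd, nerve_elt_vadd]
        exact (f i).vadd_mem _⟩,
    fun i j k => by
      refine ⟨Subtype.ext ?_, RestrictedArrow.ext ?_ rfl⟩
      · change ((f j).toFun _ +ᵥ _) = _ +ᵥ ((f k).toFun _ +ᵥ _)
        rw [add_vadd, neg_vadd_vadd, add_vadd, nerve_elt_vadd]
      · change _ + _ + -_ + (_ + _ + -_) = _ + _ + -_
        rw [← nerve_elt_add g (v i) (v j) (v k)]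
        simp only [add_assoc, neg_add_cancel_left]⟩

/-- Followed by the vertex map `0`, which is a local homeomorphism, it becomes `(f 0).move` after
the vertex map `v 0`. Local homeomorphisms cancel on the left once continuity is known, and
continuity holds because the group entries are locally constant. -/
theorem isLocalHomeomorph_translateNerve {m n : ℕ} (v : Fin (m + 1) → Fin (n + 1))
    (f : Fin (m + 1) → PiecewiseTranslation A Y Y') :
    IsLocalHomeomorph (translateNerve v f) := by
  refine IsLocalHomeomorph.of_comp (g := Nerve.vertex (restrictedTransformationGroupoid A Y') 0)
    ?_ (Nerve.isLocalHomeomorph_vertex (restrictedTransformationGroupoid_isEtale A Y') 0) ?_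
  · exact (f 0).isLocalHomeomorph_move.comp
      (Nerve.isLocalHomeomorph_vertex (restrictedTransformationGroupoid_isEtale A Y) (v 0))
  refine Continuous.subtype_mk (continuous_pi fun i => continuous_pi fun j =>
    RestrictedArrow.continuous_mk_iff.2 ⟨?_, ?_⟩) _
  · let _ : TopologicalSpace A := ⊥
    have : DiscreteTopology A := ⟨rfl⟩
    refine IsLocallyConstant.continuous ?_
    refine IsLocallyConstant.add (IsLocallyConstant.add
      ((f i).isLocallyConstant.comp_continuous (continuous_vertex _)) ?_)
      ((f j).isLocallyConstant.comp_continuous (continuous_vertex _)).neg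
    exact (IsLocallyConstant.iff_continuous _).2 (RestrictedArrow.continuous_elt.comp
      ((continuous_apply (v j)).comp ((continuous_apply (v i)).comp continuous_subtype_val)))
  · exact continuous_subtype_val.comp
      ((f j).isLocalHomeomorph_move.continuous.comp (continuous_vertex _))

theorem translateNerve_comp {n : ℕ} (f' : PiecewiseTranslation A Y' Y'')
    (f : PiecewiseTranslation A Y Y') :
    translateNerve (n := n) id (fun _ => f') ∘ translateNerve id (fun _ => f) =
      translateNerve id (fun _ => f'.comp f) := by
  funext g
  refine nerve_ext (fun i j => ?_) fun j => Subtype.ext ?_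
  · change _ + (_ + _ + -_) + -_ = (_ + _) + _ + -(_ + _)
    simp only [neg_add_rev, add_assoc]
    rfl
  · exact (add_vadd _ _ _).symm

theorem translateNerve_ofLE_refl {n : ℕ} :
    translateNerve (n := n) id (fun _ => PiecewiseTranslation.ofLE A (le_refl Y)) = id := by
  funext g
  refine nerve_ext (fun i j => ?_) fun j => Subtype.ext (zero_vadd A _)
  change 0 + _ + -0 = _
  rw [neg_zero, add_zero, zero_add]
  rfl

variable [T2Space Z]

/-- The map of modules of compactly supported functions induced by `translateNerve`. -/
noncomputable def translateHom {m n : ℕ} (v : Fin (m + 1) → Fin (n + 1))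
    (f : Fin (m + 1) → PiecewiseTranslation A Y Y') :
    ModuleCat.of ℤ C_c((restrictedTransformationGroupoid A Y).Nerve n, ℤ) ⟶
      ModuleCat.of ℤ C_c((restrictedTransformationGroupoid A Y').Nerve m, ℤ) :=
  ModuleCat.ofHom (pushforward (translateNerve v f) (isLocalHomeomorph_translateNerve v f))

theorem pushforward_congr {X X' : Type} [TopologicalSpace X] [TopologicalSpace X'] [T2Space X]
    [T2Space X'] {f g : X → X'} (hf : IsLocalHomeomorph f) (h : f = g) :
    pushforward f hf = pushforward g (h ▸ hf) := by
  subst h; rfl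

/-- Simplicial operators merely select vertices. Together with `map_comp_translateHom` this reduces
every simplicial identity for the maps `translateHom` to an identity between functions on vertex
indices. -/
theorem translateHom_comp_map {m n : SimplexCategory} {l : ℕ} (u : m ⟶ n)
    (v : Fin (n.len + 1) → Fin (l + 1)) (f : Fin (n.len + 1) → PiecewiseTranslation A Y Y') :
    translateHom v f ≫
      (simplicialModule (restrictedTransformationGroupoid_isEtale A Y')).map u.op =
      translateHom (v ∘ u.toOrderHom) (f ∘ u.toOrderHom) := by
  ext1
  exact (pushforward_comp (Nerve.reindex _ u.toOrderHom)
    (Nerve.isLocalHomeomorph_reindex (restrictedTransformationGroupoid_isEtale A Y') _)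
    (translateNerve v f) (isLocalHomeomorph_translateNerve v f)
    (isLocalHomeomorph_translateNerve (v ∘ u.toOrderHom) (f ∘ u.toOrderHom))).symm

theorem map_comp_translateHom {m n : SimplexCategory} {l : ℕ} (u : m ⟶ n)
    (v : Fin (l + 1) → Fin (m.len + 1)) (f : Fin (l + 1) → PiecewiseTranslation A Y Y') :
    (simplicialModule (restrictedTransformationGroupoid_isEtale A Y)).map u.op ≫
      translateHom v f = translateHom (u.toOrderHom ∘ v) f := by
  ext1
  exact (pushforward_comp (translateNerve v f) (isLocalHomeomorph_translateNerve v f)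
    (Nerve.reindex _ u.toOrderHom)
    (Nerve.isLocalHomeomorph_reindex (restrictedTransformationGroupoid_isEtale A Y) _)
    (isLocalHomeomorph_translateNerve (u.toOrderHom ∘ v) f)).symm

/-- The simplicial map induced by a piecewise translation. -/
noncomputable def translateSimplicial (f : PiecewiseTranslation A Y Y') :
    simplicialModule (restrictedTransformationGroupoid_isEtale A Y) ⟶
      simplicialModule (restrictedTransformationGroupoid_isEtale A Y') where
  app n := translateHom (n := n.unop.len) id fun _ => f
  naturality _ _ u :=
    (map_comp_translateHom u.unop id fun _ => f).trans
      (translateHom_comp_map u.unop id fun _ => f).symm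

theorem translateSimplicial_comp (f' : PiecewiseTranslation A Y' Y'')
    (f : PiecewiseTranslation A Y Y') :
    translateSimplicial f ≫ translateSimplicial f' = translateSimplicial (f'.comp f) := by
  refine NatTrans.ext (funext fun n => ModuleCat.hom_ext ?_)
  refine (pushforward_comp _ (isLocalHomeomorph_translateNerve _ _) _
    (isLocalHomeomorph_translateNerve _ _) ((isLocalHomeomorph_translateNerve _ _).comp
      (isLocalHomeomorph_translateNerve _ _))).symm.trans ?_
  exact pushforward_congr _ (translateNerve_comp f' f)

theorem translateSimplicial_ofLE_refl :
    translateSimplicial (PiecewiseTranslation.ofLE A (le_refl Y)) = 𝟙 _ := by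
  refine NatTrans.ext (funext fun n => ModuleCat.hom_ext ?_)
  exact (pushforward_congr (isLocalHomeomorph_translateNerve _ _) translateNerve_ofLE_refl).trans
    (pushforward_id (Homeomorph.refl _).isLocalHomeomorph)

/-- Vertices up to `i` are moved by `f`, later ones by `f'`. -/
def prismTranslation (f f' : PiecewiseTranslation A Y Y') {n : ℕ} (i : Fin (n + 1))
    (k : Fin (n + 2)) : PiecewiseTranslation A Y Y' :=
  if k ≤ i.castSucc then f else f'

omit [ContinuousConstVAdd A Z] [T2Space Z] in
theorem prismTranslation_congr (f f' : PiecewiseTranslation A Y Y') {n n' : ℕ} {i : Fin (n + 1)}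
    {k : Fin (n + 2)} {i' : Fin (n' + 1)} {k' : Fin (n' + 2)}
    (h : (k : ℕ) ≤ i ↔ (k' : ℕ) ≤ i') : prismTranslation f f' i k = prismTranslation f f' i' k' :=
  if_congr h rfl rfl

theorem val_δ {n : ℕ} (i : Fin (n + 2)) (k : Fin (n + 1)) :
    ((SimplexCategory.δ i).toOrderHom k : ℕ) = if (k : ℕ) < i then (k : ℕ) else k + 1 := by
  change (i.succAbove k : ℕ) = _
  rw [Fin.succAbove]
  simp only [Fin.lt_def, Fin.val_castSucc]
  split_ifs <;> simp

theorem val_predAbove {n : ℕ} (i : Fin (n + 1)) (k : Fin (n + 2)) :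
    (i.predAbove k : ℕ) = if (i : ℕ) < k then (k : ℕ) - 1 else k := by
  rw [Fin.predAbove]
  simp only [Fin.lt_def, Fin.val_castSucc]
  split_ifs <;> simp

theorem val_σ {n : ℕ} (i : Fin (n + 1)) (k : Fin (n + 2)) :
    ((SimplexCategory.σ i).toOrderHom k : ℕ) = if (i : ℕ) < k then (k : ℕ) - 1 else k :=
  val_predAbove i k

theorem translateHom_congr {m n : ℕ} {v v' : Fin (m + 1) → Fin (n + 1)}
    {f f' : Fin (m + 1) → PiecewiseTranslation A Y Y'} (hv : ∀ k, v k = v' k)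
    (hf : ∀ k, f k = f' k) : translateHom v f = translateHom v' f' := by
  obtain rfl : v = v' := funext hv
  obtain rfl : f = f' := funext hf
  rfl

set_option linter.unusedSimpArgs false in
/-- Any two piecewise translations from `Y` to `Y'` induce homotopic simplicial maps. -/
noncomputable def translateHomotopy (f f' : PiecewiseTranslation A Y Y') :
    SimplicialObject.Homotopy (translateSimplicial f) (translateSimplicial f') where
  -- The prism operator: the `i`-th vertex is repeated, its first copy is moved by `f` and its
  -- second by `f'`. Deleting the first vertex for `i = 0` leaves only `f'`, deleting the last one
  -- for `i = n` leaves only `f`.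
  h {n} i := translateHom (m := n + 1) (n := n) i.predAbove (prismTranslation f f' i)
  h_zero_comp_δ_zero n := by
    refine (translateHom_comp_map (SimplexCategory.δ 0) _ _).trans (translateHom_congr ?_ ?_)
    · exact fun k => Fin.predAbove_zero_succ
    · exact fun k => if_neg (t := f) (Fin.not_le.2 (Fin.succ_pos k))
  h_last_comp_δ_last n := by
    refine (translateHom_comp_map (SimplexCategory.δ _) _ _).trans (translateHom_congr ?_ ?_)
    · exact fun k => Fin.ext (by simp only [val_predAbove, val_δ, val_σ, Function.comp_apply, id_eq, Fin.val_succ,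
        Fin.val_castSucc, Fin.val_last, Fin.val_zero, Fin.le_def, Fin.lt_def] at *; split_ifs <;> omega)
    · exact fun k => if_pos (by rw [Fin.le_iff_val_le_val]; simp only [val_predAbove, val_δ, val_σ, Function.comp_apply, id_eq, Fin.val_succ,
        Fin.val_castSucc, Fin.val_last, Fin.val_zero, Fin.le_def, Fin.lt_def] at *; split_ifs <;> omega)
  h_succ_comp_δ_castSucc_of_lt {n} i j hij := by
    refine (translateHom_comp_map (SimplexCategory.δ _) _ _).trans
      (.trans ?_ (map_comp_translateHom (SimplexCategory.δ _) _ _).symm)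
    refine translateHom_congr ?_ ?_
    · exact fun k => Fin.ext (by simp only [val_predAbove, val_δ, val_σ, Function.comp_apply, id_eq, Fin.val_succ,
        Fin.val_castSucc, Fin.val_last, Fin.val_zero, Fin.le_def, Fin.lt_def] at *; split_ifs <;> omega)
    · exact fun k => prismTranslation_congr f f' (by simp only [val_predAbove, val_δ, val_σ, Function.comp_apply, id_eq, Fin.val_succ,
        Fin.val_castSucc, Fin.val_last, Fin.val_zero, Fin.le_def, Fin.lt_def] at *; split_ifs <;> omega)
  h_succ_comp_δ_castSucc_succ {n} j := by
    refine (translateHom_comp_map (SimplexCategory.δ _) _ _).trans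
      (.trans ?_ (translateHom_comp_map (SimplexCategory.δ _) _ _).symm)
    refine translateHom_congr ?_ ?_
    · exact fun k => Fin.ext (by simp only [val_predAbove, val_δ, val_σ, Function.comp_apply, id_eq, Fin.val_succ,
        Fin.val_castSucc, Fin.val_last, Fin.val_zero, Fin.le_def, Fin.lt_def] at *; split_ifs <;> omega)
    · exact fun k => prismTranslation_congr f f' (by simp only [val_predAbove, val_δ, val_σ, Function.comp_apply, id_eq, Fin.val_succ,
        Fin.val_castSucc, Fin.val_last, Fin.val_zero, Fin.le_def, Fin.lt_def] at *; split_ifs <;> omega)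
  h_castSucc_comp_δ_succ_of_lt {n} i j hji := by
    refine (translateHom_comp_map (SimplexCategory.δ _) _ _).trans
      (.trans ?_ (map_comp_translateHom (SimplexCategory.δ _) _ _).symm)
    refine translateHom_congr ?_ ?_
    · exact fun k => Fin.ext (by simp only [val_predAbove, val_δ, val_σ, Function.comp_apply, id_eq, Fin.val_succ,
        Fin.val_castSucc, Fin.val_last, Fin.val_zero, Fin.le_def, Fin.lt_def] at *; split_ifs <;> omega)
    · exact fun k => prismTranslation_congr f f' (by simp only [val_predAbove, val_δ, val_σ, Function.comp_apply, id_eq, Fin.val_succ,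
        Fin.val_castSucc, Fin.val_last, Fin.val_zero, Fin.le_def, Fin.lt_def] at *; split_ifs <;> omega)
  h_comp_σ_castSucc_of_le {n} i j hij := by
    refine (translateHom_comp_map (SimplexCategory.σ _) _ _).trans
      (.trans ?_ (map_comp_translateHom (SimplexCategory.σ _) _ _).symm)
    refine translateHom_congr ?_ ?_
    · exact fun k => Fin.ext (by simp only [val_predAbove, val_δ, val_σ, Function.comp_apply, id_eq, Fin.val_succ,
        Fin.val_castSucc, Fin.val_last, Fin.val_zero, Fin.le_def, Fin.lt_def] at *; split_ifs <;> omega)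
    · exact fun k => prismTranslation_congr f f' (by simp only [val_predAbove, val_δ, val_σ, Function.comp_apply, id_eq, Fin.val_succ,
        Fin.val_castSucc, Fin.val_last, Fin.val_zero, Fin.le_def, Fin.lt_def] at *; split_ifs <;> omega)
  h_comp_σ_succ_of_lt {n} i j hji := by
    refine (translateHom_comp_map (SimplexCategory.σ _) _ _).trans
      (.trans ?_ (map_comp_translateHom (SimplexCategory.σ _) _ _).symm)
    refine translateHom_congr ?_ ?_
    · exact fun k => Fin.ext (by simp only [val_predAbove, val_δ, val_σ, Function.comp_apply, id_eq, Fin.val_succ,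
        Fin.val_castSucc, Fin.val_last, Fin.val_zero, Fin.le_def, Fin.lt_def] at *; split_ifs <;> omega)
    · exact fun k => prismTranslation_congr f f' (by simp only [val_predAbove, val_δ, val_σ, Function.comp_apply, id_eq, Fin.val_succ,
        Fin.val_castSucc, Fin.val_last, Fin.val_zero, Fin.le_def, Fin.lt_def] at *; split_ifs <;> omega)

/-- If the points of `Z` can be moved into `Y` by a piecewise translation, then restricting the
transformation groupoid to `Y` does not change its homology. -/
noncomputable def homologyRestrictIso (f : PiecewiseTranslation A (⊤ : Opens Z) Y) (k : ℕ) :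
    homology (restrictedTransformationGroupoid_isEtale A Y) k ≅
      homology (restrictedTransformationGroupoid_isEtale A (⊤ : Opens Z)) k :=
  HomotopyEquiv.toHomologyIso (i := k)
    { hom := (AlgebraicTopology.alternatingFaceMapComplex (ModuleCat.{0} ℤ)).map
        (translateSimplicial (PiecewiseTranslation.ofLE A le_top))
      inv := (AlgebraicTopology.alternatingFaceMapComplex (ModuleCat.{0} ℤ)).map
        (translateSimplicial f)
      -- Each composite comes from a piecewise translation of a space to itself, which is homotopic
      -- to the one with constant value `0`, the identity.
      homotopyHomInvId := (Homotopy.ofEq (by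
          rw [← Functor.map_comp, translateSimplicial_comp])).trans
        ((translateHomotopy _ (PiecewiseTranslation.ofLE A le_rfl)).toChainHomotopy.trans
          (Homotopy.ofEq (by rw [translateSimplicial_ofLE_refl]; exact CategoryTheory.Functor.map_id _ _)))
      homotopyInvHomId := (Homotopy.ofEq (by
          rw [← Functor.map_comp, translateSimplicial_comp])).trans
        ((translateHomotopy _ (PiecewiseTranslation.ofLE A le_rfl)).toChainHomotopy.trans
          (Homotopy.ofEq (by rw [translateSimplicial_ofLE_refl]; exact CategoryTheory.Functor.map_id _ _))) }

end Translations

end GroupoidHomology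

namespace GroupoidHomology

open TopologicalGroupoid TopologicalSpace

/-! ### Compactly supported functions on a disjoint union -/

section DisjointUnion

variable {D X Z : Type} [TopologicalSpace X] [T2Space X] [TopologicalSpace Z] [T2Space Z]

theorem pushforward_apply_of_injective {f : Z → X} (hf : IsLocalHomeomorph f)
    (hinj : f.Injective) (φ : C_c(Z, ℤ)) (z : Z) : pushforward f hf φ (f z) = φ z := by
  rw [pushforward_apply]
  have : f ⁻¹' {f z} = {z} := by
    ext x; exact hinj.eq_iff
  rw [this, finsum_mem_singleton]

theorem pushforward_apply_of_notMem_range {f : Z → X} (hf : IsLocalHomeomorph f)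
    (φ : C_c(Z, ℤ)) {x : X} (hx : x ∉ Set.range f) : pushforward f hf φ x = 0 := by
  rw [pushforward_apply]
  have : f ⁻¹' {x} = ∅ := by
    ext z; simpa using fun h => hx ⟨z, h⟩
  rw [this, finsum_mem_empty]

variable (e : D → Z → X) (he : ∀ d, IsLocalHomeomorph (e d))
  (hbij : Function.Bijective fun p : D × Z => e p.1 p.2)

include hbij in
theorem sum_pushforward_apply (φ : D →₀ C_c(Z, ℤ)) (d : D) (z : Z) :
    (φ.sum fun d' ψ => pushforward (e d') (he d') ψ) (e d z) = φ d z := by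
  classical
  have h1 : (φ.sum fun d' ψ => pushforward (e d') (he d') ψ) (e d z) =
      ∑ d' ∈ φ.support, pushforward (e d') (he d') (φ d') (e d z) := by
    rw [Finsupp.sum, CompactlySupportedContinuousMap.coe_sum, Finset.sum_apply]
  rw [h1, Finset.sum_eq_single d]
  · exact pushforward_apply_of_injective (he d)
      (fun a b h => congrArg Prod.snd (hbij.1 (a₁ := (d, a)) (a₂ := (d, b)) h)) _ _
  · intro d' _ hd'
    refine pushforward_apply_of_notMem_range _ _ ?_
    rintro ⟨z', h⟩
    exact hd' (congrArg Prod.fst (hbij.1 (a₁ := (d', z')) (a₂ := (d, z)) h))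
  · intro hd
    rw [Finsupp.notMem_support_iff.1 hd, map_zero]
    rfl

-- The pieces `e d '' Z` form an open partition, so each is closed too and restriction to it
-- preserves compact support; a compact support meets only finitely many of them.
include he hbij in
theorem exists_sum_pushforward_eq (φ : C_c(X, ℤ)) :
    ∃ ψ : D →₀ C_c(Z, ℤ), (ψ.sum fun d χ => pushforward (e d) (he d) χ) = φ := by
  classical
  have hopen : ∀ d, IsOpen (Set.range (e d)) := fun d => (he d).isOpenMap.isOpen_range
  have hinj : ∀ d, (e d).Injective := fun d a b h =>
    congrArg Prod.snd (hbij.1 (a₁ := (d, a)) (a₂ := (d, b)) h)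
  have hclosed : ∀ d, IsClosed (Set.range (e d)) := by
    intro d
    have : (Set.range (e d))ᶜ = ⋃ d' ∈ {d' | d' ≠ d}, Set.range (e d') := by
      ext x
      simp only [Set.mem_compl_iff, Set.mem_iUnion, Set.mem_ofPred_eq, exists_prop]
      constructor
      · intro hx
        obtain ⟨⟨d', z⟩, rfl⟩ := hbij.2 x
        exact ⟨d', fun h => hx ⟨z, by rw [h]⟩, z, rfl⟩
      · rintro ⟨d', hd', z, rfl⟩ ⟨z', h⟩
        exact hd' (congrArg Prod.fst (hbij.1 (a₁ := (d, z')) (a₂ := (d', z)) h)).symm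
    rw [← isOpen_compl_iff, this]
    exact isOpen_biUnion fun d' _ => hopen d'
  have hemb : ∀ d, IsClosedEmbedding (e d) := fun d =>
    ⟨((he d).isOpenEmbedding_of_injective (hinj d)).isEmbedding, hclosed d⟩
  let ψ : D → C_c(Z, ℤ) := fun d =>
    { toFun := fun z => φ (e d z)
      continuous_toFun := φ.continuous.comp (he d).continuous
      hasCompactSupport' := φ.hasCompactSupport.comp_isClosedEmbedding (hemb d) }
  obtain ⟨s, hs⟩ := φ.hasCompactSupport.isCompact.elim_finite_subcover
    (fun d => Set.range (e d)) hopen fun x _ => by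
      obtain ⟨⟨d, z⟩, rfl⟩ := hbij.2 x
      exact Set.mem_iUnion.2 ⟨d, z, rfl⟩
  have hψ : ∀ d, ψ d ≠ 0 → d ∈ s := by
    intro d hd
    by_contra hds
    refine hd (CompactlySupportedContinuousMap.ext fun z => ?_)
    by_contra hz
    obtain ⟨d', hd', z', h⟩ := Set.mem_iUnion₂.1 (hs (subset_tsupport φ hz))
    obtain rfl : d' = d := congrArg Prod.fst (hbij.1 (a₁ := (d', z')) (a₂ := (d, z)) h)
    exact hds hd'
  refine ⟨Finsupp.onFinset s ψ hψ, CompactlySupportedContinuousMap.ext fun x => ?_⟩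
  obtain ⟨⟨d, z⟩, rfl⟩ := hbij.2 x
  exact sum_pushforward_apply e he hbij _ d z

/-- Compactly supported functions on a disjoint union of copies of `Z`. -/
noncomputable def finsuppPushforwardEquiv : (D →₀ C_c(Z, ℤ)) ≃ₗ[ℤ] C_c(X, ℤ) :=
  LinearEquiv.ofBijective (Finsupp.lsum ℤ fun d => pushforward (e d) (he d)) <| by
    constructor
    · rw [injective_iff_map_eq_zero]
      intro φ hφ
      refine Finsupp.ext fun d => CompactlySupportedContinuousMap.ext fun z => ?_
      refine (sum_pushforward_apply e he hbij φ d z).symm.trans ?_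
      exact DFunLike.congr_fun hφ _
    · exact exists_sum_pushforward_eq e he hbij

theorem finsuppPushforwardEquiv_single (d : D) (φ : C_c(Z, ℤ)) :
    finsuppPushforwardEquiv e he hbij (Finsupp.single d φ) = pushforward (e d) (he d) φ :=
  Finsupp.lsum_single ℤ _ d φ

end DisjointUnion

/-! ### The nerve of a transformation groupoid and inhomogeneous chains -/

section InhomogeneousChains

variable (A : Type) {Z : Type} [AddGroup A] [AddAction A Z] [TopologicalSpace Z]
  [ContinuousConstVAdd A Z]

section Simplex

variable {A}

/-- The simplex with vertices `p 0 + z, …, p n + z`. -/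
def simplex {n : ℕ} (p : Fin (n + 1) → A) (z : Z) :
    (restrictedTransformationGroupoid A (⊤ : Opens Z)).Nerve n :=
  ⟨fun i j => ⟨p i + -p j, p j +ᵥ z, trivial, trivial⟩, fun i j k => by
    refine ⟨Subtype.ext ?_, RestrictedArrow.ext ?_ rfl⟩
    · change p j +ᵥ z = (p j + -p k) +ᵥ (p k +ᵥ z)
      rw [add_vadd, neg_vadd_vadd]
    · change p i + -p j + (p j + -p k) = p i + -p k
      rw [add_assoc, neg_add_cancel_left]⟩

theorem simplex_vadd {n : ℕ} (p : Fin (n + 1) → A) (a : A) (z : Z) :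
    simplex p (a +ᵥ z) = simplex (fun i => p i + a) z := by
  refine nerve_ext (fun i j => ?_) fun j => Subtype.ext (add_vadd _ _ _).symm
  change _ + -_ = _ + _ + -(_ + _)
  rw [neg_add_rev, add_assoc, add_neg_cancel_left]

theorem isLocalHomeomorph_simplex {n : ℕ} (p : Fin (n + 1) → A) :
    IsLocalHomeomorph (simplex p : Z → _) := by
  refine IsLocalHomeomorph.of_comp
    (g := Nerve.vertex (restrictedTransformationGroupoid A (⊤ : Opens Z)) 0) ?_
    (Nerve.isLocalHomeomorph_vertex (restrictedTransformationGroupoid_isEtale A (⊤ : Opens Z)) 0) ?_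
  · exact ((Homeomorph.vadd (p 0)).trans (Homeomorph.Set.univ Z).symm).isLocalHomeomorph
  · refine Continuous.subtype_mk (continuous_pi fun i => continuous_pi fun j =>
      RestrictedArrow.continuous_mk_iff.2 ⟨?_, ?_⟩) _
    · exact @continuous_const _ _ _ ⊥ _
    · exact continuous_const_vadd (p j)

/-- The simplex with vertices `z, -g₀ + z, -g₁ - g₀ + z, …`. -/
def chainSimplex {n : ℕ} (g : Fin n → Multiplicative A) : Z →
    (restrictedTransformationGroupoid A (⊤ : Opens Z)).Nerve n :=
  simplex fun i => (Fin.partialProd g i)⁻¹.toAdd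

theorem isLocalHomeomorph_chainSimplex {n : ℕ} (g : Fin n → Multiplicative A) :
    IsLocalHomeomorph (chainSimplex g : Z → _) := isLocalHomeomorph_simplex _

/-- The arrow from the `j`-th to the `0`-th vertex has group element `Fin.partialProd g j`, so the
string `g` is recovered from quotients of consecutive partial products, and `z` is the `0`-th vertex
because the empty product is trivial. -/
theorem bijective_chainSimplex (n : ℕ) :
    Function.Bijective fun p : (Fin n → Multiplicative A) × Z => chainSimplex p.1 p.2 := by
  constructor
  · rintro ⟨g, z⟩ ⟨g', z'⟩ h
    have h1 : ∀ i j, (Fin.partialProd g i)⁻¹ * Fin.partialProd g j =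
        (Fin.partialProd g' i)⁻¹ * Fin.partialProd g' j := by
      intro i j
      have := congrArg (fun s => (s.1 i j).elt) h
      change (Fin.partialProd g i)⁻¹ * ((Fin.partialProd g j)⁻¹)⁻¹ =
        (Fin.partialProd g' i)⁻¹ * ((Fin.partialProd g' j)⁻¹)⁻¹ at this
      rwa [inv_inv, inv_inv] at this
    refine Prod.ext (funext fun i => ?_) ?_
    · have := h1 i.castSucc i.succ
      rwa [Fin.partialProd_right_inv, Fin.partialProd_right_inv] at this
    · have := congrArg (fun s => (s.1 0 0).pt) h
      change ((Fin.partialProd g 0)⁻¹).toAdd +ᵥ z = ((Fin.partialProd g' 0)⁻¹).toAdd +ᵥ z' at this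
      rwa [Fin.partialProd_zero, Fin.partialProd_zero, inv_one, toAdd_one, zero_vadd,
        zero_vadd] at this
  · intro s
    -- These are the required partial products; their consecutive quotients give the string.
    let q : Fin (n + 1) → Multiplicative A := fun i => Multiplicative.ofAdd (s.1 0 i).elt
    let z : Z := (s.1 0 0).pt
    have hq0 : (s.1 0 0).elt = 0 := by
      have := nerve_elt_add s 0 0 0
      simpa using this
    have hq : ∀ i, Fin.partialProd (fun i : Fin n => (q i.castSucc)⁻¹ * q i.succ) i = q i := by
      intro i
      have := congrFun (Fin.partialProd_left_inv q) i
      have h0 : q 0 = 1 := congrArg Multiplicative.ofAdd hq0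
      rwa [h0, one_smul] at this
    have hinv : ∀ i, -(s.1 0 i).elt = (s.1 i 0).elt := by
      intro i
      rw [neg_eq_iff_add_eq_zero, nerve_elt_add, hq0]
    refine ⟨⟨fun i => (q i.castSucc)⁻¹ * q i.succ, z⟩, ?_⟩
    have hs : (fun i => ((Fin.partialProd (fun i : Fin n => (q i.castSucc)⁻¹ * q i.succ) i)⁻¹).toAdd)
        = fun i => (s.1 i 0).elt := by
      funext i
      rw [hq]
      exact hinv i
    change simplex _ z = s
    rw [hs]
    refine nerve_ext (fun i j => ?_) fun j => Subtype.ext ?_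
    · change (s.1 i 0).elt + -(s.1 j 0).elt = _
      rw [← hinv j, neg_neg, nerve_elt_add]
    · change (s.1 j 0).elt +ᵥ (s.1 0 0).pt = _
      rw [nerve_pt_eq]
      exact nerve_elt_vadd s j 0

/-- Deleting the `0`-th vertex makes `-g₀ + z` the new base point. This change of base point is the
action of `g₀⁻¹` on coefficients in the first term of the inhomogeneous differential. -/
theorem reindex_zero_chainSimplex {n : ℕ} (g : Fin (n + 1) → Multiplicative A) :
    Nerve.reindex _ (Fin.succAbove 0) ∘ (chainSimplex g : Z → _) =
      chainSimplex (fun i => g i.succ) ∘ fun z => -(g 0).toAdd +ᵥ z := by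
  funext z
  change simplex _ z = simplex _ _
  rw [simplex_vadd]
  congr 1
  funext i
  change ((Fin.partialProd g ((0 : Fin (n + 2)).succAbove i))⁻¹).toAdd = _
  rw [Fin.zero_succAbove, Fin.partialProd_succ', mul_inv_rev]
  rfl

/-- Deleting a later vertex keeps the base point, so the coefficient is untouched and two
neighbouring entries are multiplied, or the last entry is dropped. -/
theorem reindex_succ_chainSimplex {n : ℕ} (g : Fin (n + 1) → Multiplicative A) (j : Fin (n + 1)) :
    Nerve.reindex _ (Fin.succAbove j.succ) ∘ (chainSimplex g : Z → _) =
      chainSimplex (Fin.contractNth j (· * ·) g) := by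
  funext z
  change simplex _ z = simplex _ z
  congr 1
  funext i
  rw [Fin.partialProd_contractNth]
  rfl

end Simplex

variable (Z) [T2Space Z]

/-- The representation of `A` on the compactly supported functions on `Z`. -/
noncomputable def functionRepresentation :
    Representation ℤ (Multiplicative A) C_c(Z, ℤ) where
  toFun g := pushforward (fun z => g.toAdd +ᵥ z) (Homeomorph.vadd g.toAdd).isLocalHomeomorph
  map_one' := (pushforward_congr _ (funext fun z => zero_vadd A z)).trans
    (pushforward_id (Homeomorph.refl Z).isLocalHomeomorph)
  map_mul' g h := (pushforward_congr _ (funext fun z => add_vadd g.toAdd h.toAdd z)).trans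
    (pushforward_comp (fun z => g.toAdd +ᵥ z) (Homeomorph.vadd g.toAdd).isLocalHomeomorph
      (fun z => h.toAdd +ᵥ z) (Homeomorph.vadd h.toAdd).isLocalHomeomorph
      ((Homeomorph.vadd g.toAdd).isLocalHomeomorph.comp
        (Homeomorph.vadd h.toAdd).isLocalHomeomorph))

end InhomogeneousChains

/-- The differential `∑ᵢ (-1)ⁱ (dᵢ)_*` of the homology complex of an étale groupoid. -/
noncomputable def nerveDifferential {G X : Type} [TopologicalSpace G] [TopologicalSpace X]
    [T2Space G] {𝒢 : TopologicalGroupoid G X} (h𝒢 : 𝒢.IsEtale) (n : ℕ) :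
    C_c(𝒢.Nerve (n + 1), ℤ) →ₗ[ℤ] C_c(𝒢.Nerve n, ℤ) :=
  ∑ i : Fin (n + 2), (-1 : ℤ) ^ (i : ℕ) •
    pushforward (Nerve.reindex 𝒢 (Fin.succAbove i)) (Nerve.isLocalHomeomorph_reindex h𝒢 _)

theorem chainComplex_d {G X : Type} [TopologicalSpace G] [TopologicalSpace X] [T2Space G]
    {𝒢 : TopologicalGroupoid G X} (h𝒢 : 𝒢.IsEtale) (n : ℕ) :
    (chainComplex h𝒢).d (n + 1) n = ModuleCat.ofHom (nerveDifferential h𝒢 n) := by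
  refine (AlgebraicTopology.AlternatingFaceMapComplex.obj_d_eq (simplicialModule h𝒢) n).trans
    (ModuleCat.hom_ext ?_)
  rw [ModuleCat.hom_sum]
  rfl

section InhomogeneousChains

variable (A Z : Type) [AddGroup A] [AddAction A Z] [TopologicalSpace Z]
  [ContinuousConstVAdd A Z] [T2Space Z]

/-- Inhomogeneous chains with coefficients in the compactly supported functions on `Z` are the
compactly supported functions on the nerve of the transformation groupoid. -/
noncomputable def chainsEquiv (n : ℕ) :
    ((Fin n → Multiplicative A) →₀ C_c(Z, ℤ)) ≃ₗ[ℤ]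
      C_c((restrictedTransformationGroupoid A (⊤ : Opens Z)).Nerve n, ℤ) :=
  finsuppPushforwardEquiv (fun g => chainSimplex g) isLocalHomeomorph_chainSimplex
      (bijective_chainSimplex n)

theorem chainsEquiv_single {n : ℕ} (g : Fin n → Multiplicative A) (φ : C_c(Z, ℤ)) :
    chainsEquiv A Z n (Finsupp.single g φ) =
      pushforward (chainSimplex g) (isLocalHomeomorph_chainSimplex g) φ :=
  finsuppPushforwardEquiv_single _ _ _ _ _

theorem nerveDifferential_chainsEquiv_single {n : ℕ} (g : Fin (n + 1) → Multiplicative A)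
    (φ : C_c(Z, ℤ)) :
    nerveDifferential (restrictedTransformationGroupoid_isEtale A (⊤ : Opens Z)) n
      (chainsEquiv A Z (n + 1) (Finsupp.single g φ)) =
    chainsEquiv A Z n (Finsupp.single (fun i => g i.succ)
        (functionRepresentation A Z (g 0)⁻¹ φ) + ∑ j : Fin (n + 1),
          (-1 : ℤ) ^ ((j : ℕ) + 1) • Finsupp.single (Fin.contractNth j (· * ·) g) φ) := by
  have hface : ∀ i : Fin (n + 2), pushforward (Nerve.reindex _ (Fin.succAbove i))
      (Nerve.isLocalHomeomorph_reindex (restrictedTransformationGroupoid_isEtale A (⊤ : Opens Z)) _)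
      (pushforward (chainSimplex g) (isLocalHomeomorph_chainSimplex g) φ) =
      pushforward (Nerve.reindex _ (Fin.succAbove i) ∘ chainSimplex g)
        ((Nerve.isLocalHomeomorph_reindex (restrictedTransformationGroupoid_isEtale A _) _).comp
          (isLocalHomeomorph_chainSimplex g)) φ := fun i =>
    (LinearMap.congr_fun (pushforward_comp _ (Nerve.isLocalHomeomorph_reindex
      (restrictedTransformationGroupoid_isEtale A (⊤ : Opens Z)) _) _
      (isLocalHomeomorph_chainSimplex g) _) φ).symm
  rw [chainsEquiv_single, map_add, map_sum, chainsEquiv_single, nerveDifferential,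
    LinearMap.sum_apply, Fin.sum_univ_succ]
  refine congrArg₂ (· + ·) ?_ (Finset.sum_congr rfl fun j _ => ?_)
  · rw [LinearMap.smul_apply, hface, Fin.val_zero, pow_zero, one_smul,
      pushforward_congr _ (reindex_zero_chainSimplex g)]
    exact LinearMap.congr_fun (pushforward_comp _ (isLocalHomeomorph_chainSimplex _) _
      (Homeomorph.vadd _).isLocalHomeomorph _) φ
  · rw [LinearMap.smul_apply, hface, pushforward_congr _ (reindex_succ_chainSimplex g j), map_smul,
      chainsEquiv_single]
    rfl

/-- The homology complex of a transformation groupoid is the complex of inhomogeneous chains with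
coefficients in the compactly supported functions. -/
noncomputable def inhomogeneousChainsIsoChainComplex :
    groupHomology.inhomogeneousChains (Rep.of (functionRepresentation A Z)) ≅
      chainComplex (restrictedTransformationGroupoid_isEtale A (⊤ : Opens Z)) := by
  refine HomologicalComplex.Hom.isoOfComponents
    (fun n => LinearEquiv.toModuleIso (chainsEquiv A Z n)) ?_
  rintro i n rfl
  have h1 : ModuleCat.ofHom (chainsEquiv A Z (n + 1)).toLinearMap ≫
      ModuleCat.ofHom (nerveDifferential
        (restrictedTransformationGroupoid_isEtale A (⊤ : Opens Z)) n) =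
    groupHomology.inhomogeneousChains.d (Rep.of (functionRepresentation A Z)) n ≫
      ModuleCat.ofHom (chainsEquiv A Z n).toLinearMap := by
    refine ModuleCat.hom_ext (Finsupp.lhom_ext fun g φ => ?_)
    refine (nerveDifferential_chainsEquiv_single A Z g φ).trans (congrArg (chainsEquiv A Z n) ?_)
    exact (groupHomology.inhomogeneousChains.d_single
      (A := Rep.of (functionRepresentation A Z)) n g φ).symm
  refine (congrArg _ (chainComplex_d _ n)).trans (h1.trans ?_)
  exact congrArg (· ≫ ModuleCat.ofHom (chainsEquiv A Z n).toLinearMap)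
    (groupHomology.inhomogeneousChains.d_def (A := Rep.of (functionRepresentation A Z)) n).symm

end InhomogeneousChains

end GroupoidHomology

namespace GroupoidHomology

/-! ### Acyclicity of the group ring -/

section GroupRing

variable (k G : Type) [CommRing k] [Group G]

/-- The group ring as a left regular representation. -/
noncomputable def groupRingRepresentation : Representation k G (G →₀ k) where
  toFun g := Finsupp.lmapDomain k k (g * ·)
  map_one' := Finsupp.lhom_ext fun h n => by simp
  map_mul' g g' := Finsupp.lhom_ext fun h n => by simp [mul_assoc]

variable {k G} in
theorem groupRingRepresentation_single (g h : G) (n : k) :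
    groupRingRepresentation k G g (Finsupp.single h n) = Finsupp.single (g * h) n :=
  Finsupp.mapDomain_single

/-- The augmentation of the group ring. -/
noncomputable def augmentation : (G →₀ k) →ₗ[k] k := Finsupp.lsum k fun _ => LinearMap.id

variable {k G} in
omit [Group G] in
theorem augmentation_single (g : G) (n : k) : augmentation k G (Finsupp.single g n) = n :=
  Finsupp.lsum_single k _ g n

variable {k G} in
theorem augmentation_groupRingRepresentation (g : G) (x : G →₀ k) :
    augmentation k G (groupRingRepresentation k G g x) = augmentation k G x := by
  induction x using Finsupp.induction_linear with
  | zero => simp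
  | add x y hx hy => simp only [map_add, hx, hy]
  | single h n => rw [groupRingRepresentation_single, augmentation_single, augmentation_single]

/-- The augmentation as a morphism of representations. -/
noncomputable def augmentationHom :
    Rep.of (groupRingRepresentation k G) ⟶ Rep.trivial k G k :=
  Rep.ofHom ⟨augmentation k G, fun g => LinearMap.ext fun x =>
    augmentation_groupRingRepresentation g x⟩

variable {k G}

/-- All group elements have the class of `1` in the coinvariants. Hence elements of augmentation
zero vanish there, which is what degree zero of the long exact sequence needs. -/
theorem sub_augmentation_mem_ker (x : G →₀ k) :
    x - Finsupp.single 1 (augmentation k G x) ∈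
      Representation.Coinvariants.ker (groupRingRepresentation k G) := by
  induction x using Finsupp.induction_linear with
  | zero => simp
  | add x y hx hy =>
    rw [map_add, Finsupp.single_add, add_sub_add_comm]
    exact Submodule.add_mem _ hx hy
  | single h n =>
    rw [augmentation_single]
    refine Representation.Coinvariants.mem_ker_of_eq h (Finsupp.single 1 n) _ ?_
    rw [groupRingRepresentation_single, mul_one]

/-- The contracting homotopy `[g₁|…|gₙ] a ↦ [a⁻¹|g₁|…|gₙ] 1`. -/
noncomputable def chainContraction (n : ℕ) :
    ((Fin n → G) →₀ (G →₀ k)) →ₗ[k] ((Fin (n + 1) → G) →₀ (G →₀ k)) :=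
  Finsupp.lsum k fun g => Finsupp.lsum k fun a =>
    Finsupp.lsingle (Fin.cons a⁻¹ g : Fin (n + 1) → G) ∘ₗ Finsupp.lsingle 1

theorem chainContraction_single {n : ℕ} (g : Fin n → G) (a : G) (m : k) :
    chainContraction n (Finsupp.single g (Finsupp.single a m)) =
      Finsupp.single (Fin.cons a⁻¹ g : Fin (n + 1) → G) (Finsupp.single 1 m) := by
  rw [chainContraction, Finsupp.lsum_single, Finsupp.lsum_single]
  rfl

theorem contractNth_zero_cons {n : ℕ} (a : G) (g : Fin (n + 1) → G) :
    Fin.contractNth 0 (· * ·) (Fin.cons a g : Fin (n + 2) → G) =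
      Fin.cons (a * g 0) (fun i => g i.succ) := by
  funext k
  refine Fin.cases ?_ (fun k => ?_) k
  · simp [Fin.contractNth]
  · simp [Fin.contractNth]

theorem contractNth_succ_cons {n : ℕ} (j : Fin (n + 1)) (a : G) (g : Fin (n + 1) → G) :
    Fin.contractNth j.succ (· * ·) (Fin.cons a g : Fin (n + 2) → G) =
      Fin.cons a (Fin.contractNth j (· * ·) g) := by
  funext k
  refine Fin.cases ?_ (fun k => ?_) k
  · simp [Fin.contractNth]
  · simp [Fin.contractNth]

omit [Group G] in
theorem neg_one_smul_add_self {V : Type} [AddCommGroup V] [Module k V] (v : V) :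
    (-1 : k) • v + v = 0 := by rw [neg_one_smul, neg_add_cancel]

/-- The identity `dh + hd = id` in positive degrees, checked on `[g₁|…|gₙ] a`. The `0`-th face of
`[a⁻¹|g₁|…|gₙ] 1` gives back the chain, because `a` acts on `1`; each other face cancels one term of
`hd`. -/
theorem d_chainContraction {n : ℕ} (x : (Fin (n + 1) → G) →₀ (G →₀ k)) :
    (groupHomology.inhomogeneousChains.d (Rep.of (groupRingRepresentation k G)) (n + 1)).hom
        (chainContraction (n + 1) x) +
      chainContraction n
        ((groupHomology.inhomogeneousChains.d (Rep.of (groupRingRepresentation k G)) n).hom x) =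
      x := by
  induction x using Finsupp.induction_linear with
  | zero => simp only [map_zero, add_zero]
  | add x y hx hy =>
    simp only [map_add]
    rw [add_add_add_comm, hx, hy]
  | single g y =>
    induction y using Finsupp.induction_linear with
    | zero => simp only [Finsupp.single_zero, map_zero, add_zero]
    | add x y hx hy =>
      simp only [Finsupp.single_add, map_add]
      rw [add_add_add_comm, hx, hy]
    | single a m =>
      have hd : ∀ (l : ℕ) (g : Fin (l + 1) → G) (a : G),
          (groupHomology.inhomogeneousChains.d (Rep.of (groupRingRepresentation k G)) l).hom
            (Finsupp.single g (Finsupp.single a m)) =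
          ((Finsupp.single (fun i => g i.succ) (Finsupp.single ((g 0)⁻¹ * a) m) +
            ∑ j : Fin (l + 1), (-1 : k) ^ ((j : ℕ) + 1) •
              Finsupp.single (Fin.contractNth j (· * ·) g) (Finsupp.single a m) :
                (Fin l → G) →₀ (G →₀ k))) := by
        intro l g a
        rw [← groupRingRepresentation_single]
        exact groupHomology.inhomogeneousChains.d_single
          (A := Rep.of (groupRingRepresentation k G)) l g (Finsupp.single a m)
      rw [chainContraction_single]
      refine (congrArg₂ (fun p q => p + chainContraction n q) (hd _ _ _) (hd _ _ _)).trans ?_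
      -- Multiplying `a⁻¹` with the first entry `g 0` matches the contraction of the `0`-th face of
      -- `[g] a`, whose coefficient is `(g 0)⁻¹ * a`.
      have h1 : (-1 : k) ^ (((0 : Fin (n + 2)) : ℕ) + 1) • Finsupp.single
          (Fin.contractNth 0 (· * ·) (Fin.cons a⁻¹ g : Fin (n + 2) → G))
            (Finsupp.single (1 : G) m) +
          chainContraction n (Finsupp.single (fun i => g i.succ)
            (Finsupp.single ((g 0)⁻¹ * a) m)) = 0 := by
        rw [chainContraction_single, contractNth_zero_cons, mul_inv_rev, inv_inv,
          Fin.val_zero, zero_add, pow_one]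
        exact neg_one_smul_add_self (k := k) (V := (Fin (n + 1) → G) →₀ (G →₀ k)) _
      -- The remaining faces do not touch the prepended entry; prepending it shifts their index by
      -- one and so reverses the sign.
      have h2 : ∀ j : Fin (n + 1), (-1 : k) ^ ((j.succ : ℕ) + 1) • Finsupp.single
          (Fin.contractNth j.succ (· * ·) (Fin.cons a⁻¹ g : Fin (n + 2) → G))
            (Finsupp.single (1 : G) m) +
          chainContraction n ((-1 : k) ^ ((j : ℕ) + 1) •
            Finsupp.single (Fin.contractNth j (· * ·) g) (Finsupp.single a m)) = 0 := by
        intro j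
        rw [map_smul, chainContraction_single, contractNth_succ_cons, Fin.val_succ, ← add_smul,
          pow_succ _ ((j : ℕ) + 1), mul_neg_one, neg_add_cancel, zero_smul]
      change _ + _ + chainContraction n (_ + _) = _
      rw [map_add, map_sum, Fin.sum_univ_succ, add_assoc, add_add_add_comm, h1,
        ← Finset.sum_add_distrib, Finset.sum_congr rfl fun j _ => h2 j, Finset.sum_const_zero,
        Fin.cons_zero, inv_inv, mul_one, add_zero, add_zero]
      rfl

theorem isZero_groupHomology_groupRing (n : ℕ) :
    Limits.IsZero (groupHomology (Rep.of (groupRingRepresentation k G)) (n + 1)) := by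
  refine (HomologicalComplex.exactAt_iff_isZero_homology _ _).1 ?_
  rw [HomologicalComplex.exactAt_iff' _ (n + 2) (n + 1) n (by simp) (by simp)]
  rw [ShortComplex.moduleCat_exact_iff]
  intro x hx
  have h0 : (groupHomology.inhomogeneousChains.d
      (Rep.of (groupRingRepresentation k G)) n).hom x = 0 := by
    rw [← groupHomology.inhomogeneousChains.d_def]
    exact hx
  have h := d_chainContraction x
  refine ⟨chainContraction (n + 1) x, ?_⟩
  rw [h0, map_zero, add_zero, ← groupHomology.inhomogeneousChains.d_def] at h
  exact h

end GroupRing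

/-! ### Dimension shifting along the augmentation sequence -/

section AugmentationIdeal

variable {k G : Type} [CommRing k] [Group G] {M : Rep.{0} k G} (f : M ⟶ Rep.of (groupRingRepresentation k G))
  (hf : Function.Injective f.hom) (hr : ∀ x : G →₀ k, augmentation k G x = 0 ↔ ∃ m : M, f.hom m = x)

include hr in
theorem comp_augmentationHom : f ≫ augmentationHom k G = 0 := by
  refine Rep.hom_ext (Representation.IntertwiningMap.ext (LinearMap.ext fun m => ?_))
  exact (hr _).2 ⟨m, rfl⟩

include hf in
theorem shortExact_augmentation :
    (ShortComplex.mk f (augmentationHom k G) (comp_augmentationHom f hr)).ShortExact where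
  exact := by
    rw [← ShortComplex.exact_map_iff_of_faithful _ (forget₂ (Rep.{0} k G) (ModuleCat.{0} k)),
      ShortComplex.moduleCat_exact_iff]
    exact fun x hx => (hr x).1 hx
  mono_f := (Rep.mono_iff_injective f).2 hf
  epi_g := (Rep.epi_iff_surjective _).2 fun n =>
    ⟨Finsupp.single 1 n, augmentation_single (1 : G) n⟩

theorem H0π_comp_functor_map {M N : Rep.{0} k G} (f : M ⟶ N) :
    groupHomology.H0π M ≫ (groupHomology.functor k G 0).map f =
      f.toModuleCatHom ≫ groupHomology.H0π N :=
  groupHomology.H0π_comp_map (f := MonoidHom.id G) f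

-- `H₀` is the group of coinvariants, and the image of `f` consists of elements of augmentation
-- zero, which die in the coinvariants of the group ring.
include hr in
theorem map_groupHomology_zero : (groupHomology.functor k G 0).map f = 0 := by
  refine (cancel_epi (groupHomology.H0π M)).1 ?_
  rw [H0π_comp_functor_map, ← groupHomology.coinvariantsMk_comp_H0Iso_inv]
  have h : f.toModuleCatHom ≫
      (Rep.coinvariantsMk k G).app (Rep.of (groupRingRepresentation k G)) = 0 := by
    refine ModuleCat.hom_ext (LinearMap.ext fun m => ?_)
    refine (Representation.Coinvariants.mk_eq_zero _).2 ?_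
    have h := sub_augmentation_mem_ker (f.hom m)
    rw [(hr _).2 ⟨m, rfl⟩, Finsupp.single_zero, sub_zero] at h
    exact h
  rw [← Category.assoc]
  refine (congrArg (· ≫ _) h).trans ?_
  exact Limits.zero_comp.trans Limits.comp_zero.symm

include hf in
theorem isIso_δ_augmentation (n : ℕ) :
    IsIso (groupHomology.δ (shortExact_augmentation f hf hr) (n + 1) n rfl) := by
  cases n with
  -- `H₀` of the group ring need not vanish, so only injectivity follows from acyclicity;
  -- surjectivity follows from exactness and the vanishing of `H₀(M) → H₀(k[G])`.
  | zero =>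
    have h1 := groupHomology.mono_δ_of_isZero (shortExact_augmentation f hf hr) 0
      (isZero_groupHomology_groupRing 0)
    have h2 : Epi (groupHomology.δ (shortExact_augmentation f hf hr) 1 0 rfl) :=
      (groupHomology.mapShortComplex₁_exact (shortExact_augmentation f hf hr) rfl).epi_f
        (map_groupHomology_zero f hr)
    exact isIso_of_mono_of_epi _
  | succ n =>
    exact groupHomology.isIso_δ_of_isZero (shortExact_augmentation f hf hr) (n + 1)
      (isZero_groupHomology_groupRing (n + 1)) (isZero_groupHomology_groupRing n)

/-- Homology with coefficients in the augmentation ideal. -/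
noncomputable def groupHomologyAugmentationIso (n : ℕ) :
    groupHomology M n ≅ groupHomology (Rep.trivial k G k) (n + 1) :=
  have := isIso_δ_augmentation f hf hr n
  (asIso (groupHomology.δ (shortExact_augmentation f hf hr) (n + 1) n rfl)).symm

end AugmentationIdeal

end GroupoidHomology

namespace GroupoidHomology

/-! ### Order and topology of the line with doubled points -/

namespace SplitLine

variable {Γ : AddSubgroup ℝ}

theorem plus_le_iff (a : Γ) (x : SplitLine Γ) :
    plus a ≤ x ↔ (a : ℝ) < x.val ∨ (a : ℝ) = x.val ∧ x.upper = true := by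
  rw [le_iff]
  cases h : x.upper <;> simp [plus]

theorem le_minus_iff (x : SplitLine Γ) (a : Γ) :
    x ≤ minus a ↔ x.val < a ∨ x.val = a ∧ x.upper = false := by
  rw [le_iff]
  cases h : x.upper <;> simp [minus]

theorem val_mono {x y : SplitLine Γ} (h : x ≤ y) : x.val ≤ y.val := by
  rcases le_iff.1 h with h | h
  · exact h.le
  · exact h.1.le

theorem plus_le_plus_iff (a b : Γ) : plus a ≤ plus b ↔ a ≤ b := by
  rw [plus_le_iff, ← Subtype.coe_le_coe, le_iff_lt_or_eq]
  simp [plus]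

theorem plus_le_minus_iff (a b : Γ) : plus a ≤ minus b ↔ a < b := by
  rw [plus_le_iff, ← Subtype.coe_lt_coe]
  simp [minus]

/-- Nothing lies between `a₋` and `a₊`. This is why rays and intervals with such endpoints are
clopen. -/
theorem not_plus_le_iff (a : Γ) (x : SplitLine Γ) : ¬ plus a ≤ x ↔ x ≤ minus a := by
  rw [plus_le_iff, le_minus_iff]
  rcases lt_trichotomy (a : ℝ) x.val with h | h | h
  · simp [h, h.not_gt, h.ne']
  · simp [h]
  · simp [h, h.not_gt, h.ne']

/-- Let `s` be the supremum of the real values. If `s₊` belongs to the set it is the maximum;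
otherwise all points are at most the point over `s` with `upper = false`, and no smaller upper bound
exists. Completeness makes closed intervals compact. -/
theorem exists_isLUB {S : Set (SplitLine Γ)} (hS : S.Nonempty) (hb : BddAbove S) :
    ∃ x, IsLUB S x := by
  obtain ⟨u, hu⟩ := hb
  have hlub : IsLUB (val '' S) (sSup (val '' S)) := by
    refine isLUB_csSup (hS.image _) ⟨u.val, ?_⟩
    rintro _ ⟨x, hx, rfl⟩
    exact val_mono (hu hx)
  by_cases h : ∃ x ∈ S, x.val = sSup (val '' S) ∧ x.upper = true
  · obtain ⟨x, hx, hxv, hxu⟩ := h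
    refine ⟨x, fun y hy => ?_, fun y hy => hy hx⟩
    rw [le_iff, hxu, hxv]
    exact (hlub.1 ⟨y, hy, rfl⟩).lt_or_eq.imp id fun h => ⟨h, Bool.le_true _⟩
  · refine ⟨⟨sSup (val '' S), false, by simp⟩, fun y hy => ?_, fun y hy => ?_⟩
    · rw [le_iff]
      refine (hlub.1 ⟨y, hy, rfl⟩).lt_or_eq.imp id fun h' => ⟨h', ?_⟩
      cases hyu : y.upper
      · exact le_rfl
      · exact (h ⟨y, hy, h', hyu⟩).elim
    · rw [le_iff]
      refine (hlub.2 ?_).lt_or_eq.imp id fun h => ⟨h, Bool.false_le _⟩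
      rintro _ ⟨x, hx, rfl⟩
      exact val_mono (hy hx)

open Classical in
/-- Suprema of bounded sets make `ℝ_Γ` a conditionally complete linear order. -/
@[reducible] noncomputable def conditionallyCompleteLinearOrder :
    ConditionallyCompleteLinearOrder (SplitLine Γ) :=
  let sup : Set (SplitLine Γ) → SplitLine Γ := fun S =>
    if h : S.Nonempty ∧ BddAbove S then (exists_isLUB h.1 h.2).choose else minus 0
  have hsup : ∀ S, S.Nonempty → BddAbove S → IsLUB S (sup S) := fun S h h' => by
    simp only [sup, dif_pos (And.intro h h')]
    exact (exists_isLUB h h').choose_spec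
  { (inferInstance : LinearOrder (SplitLine Γ)), (inferInstance : Lattice (SplitLine Γ)) with
    sSup := sup
    sInf := fun S => if S.Nonempty ∧ BddBelow S then sup (lowerBounds S) else minus 0
    isLUB_csSup := hsup
    isGLB_csInf := fun S h h' => by
      rw [if_pos ⟨h, h'⟩, ← isLUB_lowerBounds]
      exact hsup _ h' (h.mono fun x hx y hy => hy hx)
    csSup_of_not_bddAbove := fun S h => by simp [sup, h]
    csInf_of_not_bddBelow := fun S h => by simp [h] }

instance : CompactIccSpace (SplitLine Γ) :=
  let _ : ConditionallyCompleteLinearOrder (SplitLine Γ) := conditionallyCompleteLinearOrder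
  ConditionallyCompleteLinearOrder.toCompactIccSpace (SplitLine Γ)

instance : NoMaxOrder (SplitLine Γ) where
  exists_gt x := ⟨⟨x.val + 1, false, by simp⟩, lt_iff.2 (Or.inl (by simp))⟩

instance : NoMinOrder (SplitLine Γ) where
  exists_lt x := ⟨⟨x.val - 1, false, by simp⟩, lt_iff.2 (Or.inl (by simp))⟩

theorem isClopen_Ici_plus (a : Γ) : IsClopen (Set.Ici (plus a)) := by
  refine ⟨isClosed_Ici, ?_⟩
  have : Set.Ici (plus a) = Set.Ioi (minus a) := by
    ext x
    rw [Set.mem_Ici, Set.mem_Ioi, ← not_le, ← not_plus_le_iff, not_not]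
  rw [this]
  exact isOpen_Ioi

theorem isClopen_Icc_plus_minus (a b : Γ) : IsClopen (Set.Icc (plus a) (minus b)) := by
  have : Set.Icc (plus a) (minus b) = Set.Ici (plus a) ∩ (Set.Ici (plus b))ᶜ := by
    ext x
    rw [Set.mem_inter_iff, Set.mem_compl_iff, Set.mem_Ici, Set.mem_Ici, not_plus_le_iff]; rfl
  rw [this]
  exact (isClopen_Ici_plus a).inter (isClopen_Ici_plus b).compl

/-- The intervals `[a₊, b₋]` form a basis. Density supplies an endpoint strictly between two
distinct real values; if instead `l` and `x` lie over the same real number, then `x` is itself of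
the form `a₊`, and dually on the right. -/
theorem exists_mem_Icc_subset (hΓ : Dense (Γ : Set ℝ)) {U : Set (SplitLine Γ)} (hU : IsOpen U)
    {x : SplitLine Γ} (hx : x ∈ U) :
    ∃ a b : Γ, x ∈ Set.Icc (plus a) (minus b) ∧ Set.Icc (plus a) (minus b) ⊆ U := by
  obtain ⟨l, u, ⟨hl, hu⟩, hlu⟩ := mem_nhds_iff_exists_Ioo_subset.1 (hU.mem_nhds hx)
  have h1 : ∃ a : Γ, plus a ≤ x ∧ l < plus a := by
    rcases lt_iff.1 hl with h | ⟨h, h'⟩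
    · obtain ⟨a, ha, hla, hax⟩ := hΓ.exists_between h
      exact ⟨⟨a, ha⟩, (plus_le_iff _ _).2 (Or.inl hax), lt_iff.2 (Or.inl hla)⟩
    · obtain ⟨hl', hx'⟩ := Bool.lt_iff.1 h'
      have hm := x.mem_of_upper hx'
      exact ⟨⟨x.val, hm⟩, (plus_le_iff _ _).2 (Or.inr ⟨rfl, hx'⟩),
        lt_iff.2 (Or.inr ⟨h, by rw [hl']; exact Bool.false_lt_true⟩)⟩
  have h2 : ∃ b : Γ, x ≤ minus b ∧ minus b < u := by
    rcases lt_iff.1 hu with h | ⟨h, h'⟩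
    · obtain ⟨a, ha, hla, hax⟩ := hΓ.exists_between h
      exact ⟨⟨a, ha⟩, (le_minus_iff _ _).2 (Or.inl hla), lt_iff.2 (Or.inl hax)⟩
    · obtain ⟨hx', hu'⟩ := Bool.lt_iff.1 h'
      have hm := u.mem_of_upper hu'
      exact ⟨⟨u.val, hm⟩, (le_minus_iff _ _).2 (Or.inr ⟨h, hx'⟩),
        lt_iff.2 (Or.inr ⟨rfl, by rw [hu']; exact Bool.false_lt_true⟩)⟩
  obtain ⟨a, ha, ha'⟩ := h1
  obtain ⟨b, hb, hb'⟩ := h2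
  exact ⟨a, b, ⟨ha, hb⟩, fun y hy => hlu ⟨ha'.trans_le hy.1, hy.2.trans_lt hb'⟩⟩

/-- The integer part of a point of `ℝ_Γ`: the integer `m` such that the point lies between `m₊` and
`(m + 1)₋`. -/
noncomputable def floor (x : SplitLine Γ) : ℤ := if x.upper then ⌊x.val⌋ else ⌈x.val⌉ - 1

/-- For a point `a₊` membership reads `m ≤ q x < m + 1`, for every other point `m < q x ≤ m + 1`.
Hence the floor in the first case and the ceiling minus one in the second. -/
theorem floor_vadd_mem_unitInterval (h1 : (1 : ℝ) ∈ Γ) (x : SplitLine Γ) (m : ℤ) :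
    (-m) • (⟨1, h1⟩ : Γ) +ᵥ x ∈ unitInterval h1 ↔ floor x = m := by
  have hm : (((-m) • (⟨1, h1⟩ : Γ) : Γ) : ℝ) = -m := by simp
  change plus 0 ≤ _ ∧ _ ≤ minus _ ↔ _
  rw [plus_le_iff, le_minus_iff]
  change ((0 : ℝ) < _ + x.val ∨ (0 : ℝ) = _ + x.val ∧ x.upper = true) ∧
    (_ + x.val < 1 ∨ _ + x.val = 1 ∧ x.upper = false) ↔ _
  rw [hm, floor]
  cases x.upper
  · simp only [Bool.false_eq_true, and_false, or_false, and_true, if_false]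
    rw [sub_eq_iff_eq_add, Int.ceil_eq_iff, ← le_iff_lt_or_eq]
    push_cast
    constructor <;> rintro ⟨h, h'⟩ <;> constructor <;> linarith
  · simp only [and_true, Bool.true_eq_false, and_false, or_false, if_true]
    rw [Int.floor_eq_iff, ← le_iff_lt_or_eq]
    constructor <;> rintro ⟨h, h'⟩ <;> constructor <;> linarith

/-- The fibres are translates of the open set `[0₊, 1₋]`. -/
theorem isLocallyConstant_floor (h1 : (1 : ℝ) ∈ Γ) :
    IsLocallyConstant (floor : SplitLine Γ → ℤ) := by
  rw [IsLocallyConstant.iff_isOpen_fiber]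
  intro m
  have : floor ⁻¹' {m} = {x : SplitLine Γ | (-m) • (⟨1, h1⟩ : Γ) +ᵥ x ∈ unitInterval h1} := by
    ext x
    exact (floor_vadd_mem_unitInterval h1 x m).symm
  rw [this]
  exact (unitInterval h1).isOpen.preimage (continuous_const_vadd _)

/-- Translation by integers moves all points of `ℝ_Γ` into `[0₊, 1₋]`. -/
noncomputable def translationToUnitInterval (h1 : (1 : ℝ) ∈ Γ) :
    PiecewiseTranslation Γ (⊤ : TopologicalSpace.Opens (SplitLine Γ)) (unitInterval h1) where
  toFun x := (-floor x.1) • (⟨1, h1⟩ : Γ)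
  isLocallyConstant :=
    ((isLocallyConstant_floor h1).comp fun m : ℤ => (-m) • (⟨1, h1⟩ : Γ)).comp_continuous
      continuous_subtype_val
  vadd_mem x := (floor_vadd_mem_unitInterval h1 x.1 _).2 rfl

end SplitLine
end GroupoidHomology

namespace GroupoidHomology

/-! ### Compactly supported functions as the augmentation ideal -/

namespace SplitLine

variable {Γ : AddSubgroup ℝ}

/-- The indicator function of `[a₊, ∞)`. -/
noncomputable def ray (a : Γ) : SplitLine Γ → ℤ := (Set.Ici (plus a)).indicator 1

theorem ray_apply (a : Γ) (x : SplitLine Γ) [Decidable (plus a ≤ x)] :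
    ray a x = if plus a ≤ x then 1 else 0 := by
  rw [ray, Set.indicator_apply]
  exact if_congr Iff.rfl rfl rfl

theorem ray_mul_ray (a b : Γ) : ray a * ray b = ray (max a b) := by
  classical
  have hmax : plus (max a b) = max (plus a) (plus b) :=
    Monotone.map_max fun c d h => (plus_le_plus_iff c d).2 h
  funext x
  rw [Pi.mul_apply, ray_apply, ray_apply, ray_apply, ite_zero_mul_ite_zero, hmax, one_mul]
  exact if_congr sup_le_iff.symm rfl rfl

/-- The step function with the given jumps that vanishes far to the left. -/
noncomputable def step : (Multiplicative Γ →₀ ℤ) →ₗ[ℤ] SplitLine Γ → ℤ :=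
  Finsupp.linearCombination ℤ fun a : Multiplicative Γ => ray a.toAdd

theorem step_single (a : Multiplicative Γ) (n : ℤ) :
    step (Finsupp.single a n) = n • ray a.toAdd :=
  Finsupp.linearCombination_single ℤ n a

/-- The function `ray b` jumps by one at `b` and nowhere else, so the coefficients of a step
function are its jumps. -/
theorem step_plus_sub_step_minus (x : Multiplicative Γ →₀ ℤ) (a : Multiplicative Γ) :
    step x (plus a.toAdd) - step x (minus a.toAdd) = x a := by
  classical
  induction x using Finsupp.induction_linear with
  | zero => simp
  | add x y hx hy =>
    rw [map_add, Finsupp.add_apply, Pi.add_apply, Pi.add_apply, ← hx, ← hy]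
    ring
  | single b n =>
    rw [step_single, Pi.smul_apply, Pi.smul_apply, ray_apply, ray_apply, Finsupp.single_apply,
      smul_eq_mul, smul_eq_mul]
    simp only [plus_le_plus_iff, plus_le_minus_iff]
    rcases lt_trichotomy b.toAdd a.toAdd with h | h | h
    · have h' : b ≠ a := fun e => h.ne (congrArg _ e)
      simp [h, h.le, h']
    · obtain rfl : b = a := h
      simp
    · have h' : b ≠ a := fun e => h.ne' (congrArg _ e)
      rw [if_neg h.not_ge, if_neg h.not_gt, if_neg h']
      simp

variable (Γ) in
/-- The step functions whose jumps add up to zero. -/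
noncomputable def boundedStep : Submodule ℤ (SplitLine Γ → ℤ) :=
  (LinearMap.ker (augmentation ℤ (Multiplicative Γ))).map step

/-- Since `ray a * ray b = ray (max a b)`, multiplication by `ray a` pushes the jumps forward along
`b ↦ max a b`, which preserves their sum. -/
theorem ray_mul_mem_boundedStep (a : Γ) {φ : SplitLine Γ → ℤ} (hφ : φ ∈ boundedStep Γ) :
    ray a * φ ∈ boundedStep Γ := by
  obtain ⟨x, hx, rfl⟩ := hφ
  have key : ∀ x : Multiplicative Γ →₀ ℤ,
      augmentation ℤ _ (x.mapDomain fun b => Multiplicative.ofAdd (max a b.toAdd)) =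
        augmentation ℤ _ x ∧
      step (x.mapDomain fun b => Multiplicative.ofAdd (max a b.toAdd)) = ray a * step x := by
    intro x
    induction x using Finsupp.induction_linear with
    | zero => simp
    | add x y hx hy =>
      simp only [Finsupp.mapDomain_add, map_add, hx.1, hx.2, hy.1, hy.2, mul_add, and_self]
    | single b n =>
      rw [Finsupp.mapDomain_single, augmentation_single, augmentation_single, step_single,
        step_single, mul_smul_comm, ray_mul_ray]
      exact ⟨rfl, rfl⟩
  exact ⟨_, ((key x).1.trans hx : _), (key x).2⟩

theorem ray_sub_ray_mem_boundedStep (a b : Γ) : ray a - ray b ∈ boundedStep Γ := by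
  refine ⟨Finsupp.single (Multiplicative.ofAdd a) 1 - Finsupp.single (Multiplicative.ofAdd b) 1,
    ?_, ?_⟩
  · rw [SetLike.mem_coe, LinearMap.mem_ker, map_sub, augmentation_single, augmentation_single,
      sub_self]
  · rw [map_sub, step_single, step_single, one_smul, one_smul]
    rfl

/-- The indicator function of `[a₊, b₋]`. -/
noncomputable def interval (p : Γ × Γ) : SplitLine Γ → ℤ :=
  (Set.Icc (plus p.1) (minus p.2)).indicator 1

theorem interval_eq (p : Γ × Γ) : interval p = ray p.1 - ray (max p.1 p.2) := by
  classical
  rw [← ray_mul_ray]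
  funext x
  rw [Pi.sub_apply, Pi.mul_apply, ray_apply, ray_apply, interval, Set.indicator_apply]
  simp only [Set.mem_Icc, ← not_plus_le_iff]
  by_cases h : plus p.1 ≤ x <;> by_cases h' : plus p.2 ≤ x <;> simp [h, h']

theorem interval_mem_boundedStep (p : Γ × Γ) : interval p ∈ boundedStep Γ := by
  rw [interval_eq]
  exact ray_sub_ray_mem_boundedStep _ _

theorem interval_mul_mem_boundedStep (p : Γ × Γ) {φ : SplitLine Γ → ℤ}
    (hφ : φ ∈ boundedStep Γ) : interval p * φ ∈ boundedStep Γ := by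
  rw [interval_eq, sub_mul]
  exact sub_mem (ray_mul_mem_boundedStep _ hφ) (ray_mul_mem_boundedStep _ hφ)

/-- The intervals may overlap. When one is added, the overlap is subtracted as a product with its
indicator, and `boundedStep` is closed under such products. -/
theorem indicator_biUnion_mem_boundedStep (φ : SplitLine Γ → ℤ) (T : Finset (Γ × Γ))
    (hT : ∀ p ∈ T, ∃ c : ℤ, ∀ x ∈ Set.Icc (plus p.1) (minus p.2), φ x = c) :
    (⋃ p ∈ T, Set.Icc (plus p.1) (minus p.2)).indicator φ ∈ boundedStep Γ := by
  classical
  induction T using Finset.induction_on with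
  | empty =>
    convert zero_mem (boundedStep Γ)
    simp only [Finset.notMem_empty, Set.iUnion_false, Set.iUnion_empty, Set.indicator_empty]
    rfl
  | insert p T hp ih =>
    have ih' := ih fun q hq => hT q (Finset.mem_insert_of_mem hq)
    obtain ⟨c, hc⟩ := hT p (Finset.mem_insert_self p T)
    have hsum : (⋃ q ∈ insert p T, Set.Icc (plus q.1) (minus q.2)).indicator φ =
        c • interval p + (⋃ q ∈ T, Set.Icc (plus q.1) (minus q.2)).indicator φ -
          interval p * (⋃ q ∈ T, Set.Icc (plus q.1) (minus q.2)).indicator φ := by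
      rw [Finset.set_biUnion_insert]
      generalize (⋃ q ∈ T, Set.Icc (plus q.1) (minus q.2)) = B
      funext x
      simp only [Pi.sub_apply, Pi.add_apply, Pi.mul_apply, Pi.smul_apply, interval,
        Set.indicator_apply, Set.mem_union, Pi.one_apply, smul_eq_mul]
      by_cases h : x ∈ Set.Icc (plus p.1) (minus p.2)
      · by_cases h' : x ∈ B <;> simp [h, h', hc x h]
      · by_cases h' : x ∈ B <;> simp [h, h']
    rw [hsum]
    exact sub_mem (add_mem (Submodule.smul_mem _ _ (interval_mem_boundedStep p)) ih')
      (interval_mul_mem_boundedStep p ih')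

/-- By compactness, finitely many intervals `[a₊, b₋]` on which `φ` is constant cover its support.
-/
theorem coe_mem_boundedStep (hΓ : Dense (Γ : Set ℝ)) (φ : C_c(SplitLine Γ, ℤ)) :
    ⇑φ ∈ boundedStep Γ := by
  classical
  have hloc : ∀ x : SplitLine Γ, ∃ p : Γ × Γ, x ∈ Set.Icc (plus p.1) (minus p.2) ∧
      Set.Icc (plus p.1) (minus p.2) ⊆ φ ⁻¹' {φ x} := fun x => by
    obtain ⟨a, b, h⟩ := exists_mem_Icc_subset hΓ ((isOpen_discrete {φ x}).preimage φ.continuous)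
      (x := x) rfl
    exact ⟨(a, b), h⟩
  choose p hp hp' using hloc
  obtain ⟨T, -, hT⟩ := φ.hasCompactSupport.isCompact.elim_nhds_subcover
    (fun x => Set.Icc (plus (p x).1) (minus (p x).2))
    fun x _ => (isClopen_Icc_plus_minus _ _).isOpen.mem_nhds (hp x)
  have h1 := indicator_biUnion_mem_boundedStep φ (T.image p) (by
    intro q hq
    obtain ⟨x, -, rfl⟩ := Finset.mem_image.1 hq
    exact ⟨φ x, fun y hy => hp' x hy⟩)
  rw [Set.indicator_eq_self.2] at h1
  · exact h1
  · refine (subset_tsupport φ).trans (hT.trans ?_)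
    rw [Finset.set_biUnion_finset_image]

theorem exists_coe_eq_interval (p : Γ × Γ) : ∃ φ : C_c(SplitLine Γ, ℤ), ⇑φ = interval p :=
  ⟨{ toFun := interval p
     continuous_toFun :=
      (isClopen_Icc_plus_minus p.1 p.2).continuous_indicator continuous_one
     hasCompactSupport' := HasCompactSupport.intro isCompact_Icc
      fun _ hx => Set.indicator_of_notMem hx _ }, rfl⟩

/-- A step function is constant, equal to the sum of its jumps, far to the right; subtracting that
multiple of `ray 0` makes the support compact. -/
theorem exists_coe_eq_step (x : Multiplicative Γ →₀ ℤ) :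
    ∃ φ : C_c(SplitLine Γ, ℤ), ⇑φ = step x - augmentation ℤ _ x • ray (0 : Γ) := by
  induction x using Finsupp.induction_linear with
  | zero => exact ⟨0, by simp⟩
  | add x y hx hy =>
    obtain ⟨φ, hφ⟩ := hx
    obtain ⟨ψ, hψ⟩ := hy
    refine ⟨φ + ψ, ?_⟩
    rw [CompactlySupportedContinuousMap.coe_add, hφ, hψ, map_add, map_add, add_smul]
    abel
  | single a n =>
    obtain ⟨φ, hφ⟩ := exists_coe_eq_interval (a.toAdd, (0 : Γ))
    obtain ⟨ψ, hψ⟩ := exists_coe_eq_interval ((0 : Γ), a.toAdd)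
    -- `ray a - ray 0` is the indicator of `[a₊, 0₋]` minus that of `[0₊, a₋]`, at most one of which
    -- is nonempty, so no case distinction on the sign of `a` is needed.
    refine ⟨n • (φ - ψ), ?_⟩
    rw [CompactlySupportedContinuousMap.coe_smul, CompactlySupportedContinuousMap.coe_sub, hφ, hψ,
      interval_eq, interval_eq, step_single, augmentation_single, max_comm (0 : Γ), ← smul_sub]
    congr 1
    exact sub_sub_sub_cancel_right _ _ _

theorem exists_step_eq (hΓ : Dense (Γ : Set ℝ)) (φ : C_c(SplitLine Γ, ℤ)) :
    ∃ x : Multiplicative Γ →₀ ℤ, augmentation ℤ _ x = 0 ∧ step x = φ :=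
  coe_mem_boundedStep hΓ φ

/-- The jumps of a locally constant function with compact support. -/
noncomputable def jumps (hΓ : Dense (Γ : Set ℝ)) :
    C_c(SplitLine Γ, ℤ) →ₗ[ℤ] Multiplicative Γ →₀ ℤ where
  toFun φ := Finsupp.ofSupportFinite (fun a => φ (plus a.toAdd) - φ (minus a.toAdd)) (by
    obtain ⟨x, -, hx⟩ := exists_step_eq hΓ φ
    have h : (fun a : Multiplicative Γ => φ (plus a.toAdd) - φ (minus a.toAdd)) = x :=
      funext fun a => by rw [← hx, step_plus_sub_step_minus]
    rw [h]
    exact x.hasFiniteSupport)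
  map_add' φ ψ := Finsupp.ext fun a => add_sub_add_comm _ _ _ _
  map_smul' n φ := Finsupp.ext fun a => (mul_sub n _ _).symm

theorem jumps_apply (hΓ : Dense (Γ : Set ℝ)) (φ : C_c(SplitLine Γ, ℤ)) (a : Multiplicative Γ) :
    jumps hΓ φ a = φ (plus a.toAdd) - φ (minus a.toAdd) := rfl

theorem jumps_eq (hΓ : Dense (Γ : Set ℝ)) {φ : C_c(SplitLine Γ, ℤ)} {x : Multiplicative Γ →₀ ℤ}
    (h : step x = φ) : jumps hΓ φ = x :=
  Finsupp.ext fun a => by rw [jumps_apply, ← h, step_plus_sub_step_minus]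

theorem jumps_injective (hΓ : Dense (Γ : Set ℝ)) : Function.Injective (jumps hΓ) := by
  intro φ ψ h
  obtain ⟨x, -, hx⟩ := exists_step_eq hΓ φ
  obtain ⟨y, -, hy⟩ := exists_step_eq hΓ ψ
  rw [jumps_eq hΓ hx, jumps_eq hΓ hy] at h
  exact DFunLike.coe_injective (hx.symm.trans ((congrArg step h).trans hy))

theorem augmentation_eq_zero_iff (hΓ : Dense (Γ : Set ℝ)) (x : Multiplicative Γ →₀ ℤ) :
    augmentation ℤ _ x = 0 ↔ ∃ φ, jumps hΓ φ = x := by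
  constructor
  · intro hx
    obtain ⟨φ, hφ⟩ := exists_coe_eq_step x
    exact ⟨φ, jumps_eq hΓ (by rw [hφ, hx, zero_smul, sub_zero])⟩
  · rintro ⟨φ, rfl⟩
    obtain ⟨y, hy, h⟩ := exists_step_eq hΓ φ
    rw [jumps_eq hΓ h, hy]

/-- Translation by `g` carries the pair `b₋`, `b₊` to the pair over `g + b`, so it moves the jump at
`b` to `g + b`. -/
theorem jumps_functionRepresentation (hΓ : Dense (Γ : Set ℝ)) (g : Multiplicative Γ)
    (φ : C_c(SplitLine Γ, ℤ)) :
    jumps hΓ (functionRepresentation Γ (SplitLine Γ) g φ) =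
      groupRingRepresentation ℤ (Multiplicative Γ) g (jumps hΓ φ) := by
  have h : ∀ x : SplitLine Γ,
      functionRepresentation Γ (SplitLine Γ) g φ (g.toAdd +ᵥ x) = φ x := fun x =>
    pushforward_apply_of_injective (Homeomorph.vadd g.toAdd).isLocalHomeomorph
      (AddAction.injective g.toAdd) φ x
  ext a
  obtain ⟨b, rfl⟩ : ∃ b, a = g * b := ⟨g⁻¹ * a, by rw [mul_inv_cancel_left]⟩
  refine Eq.trans ?_ (Finsupp.mapDomain_apply (mul_right_injective g) (jumps hΓ φ) b).symm
  rw [jumps_apply, jumps_apply, ← h (plus b.toAdd), ← h (minus b.toAdd)]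
  rfl

/-- The jumps as a morphism of representations. -/
noncomputable def jumpsHom (hΓ : Dense (Γ : Set ℝ)) :
    Rep.of (functionRepresentation Γ (SplitLine Γ)) ⟶
      Rep.of (groupRingRepresentation ℤ (Multiplicative Γ)) :=
  Rep.ofHom ⟨jumps hΓ, fun g => LinearMap.ext (jumps_functionRepresentation hΓ g)⟩

end SplitLine

/-! ### Assembly of the isomorphisms -/

open SplitLine

/-- The homology of `𝒢_Γ` is the shifted group homology of `Γ`. -/
noncomputable def homologyIntervalExchangeGroupoidIso (Γ : AddSubgroup ℝ)
    (hΓ : Dense (Γ : Set ℝ)) (h1 : (1 : ℝ) ∈ Γ) (k : ℕ) :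
    TopologicalGroupoid.homology (intervalExchangeGroupoid_isEtale Γ h1) k ≅
      integralGroupHomology Γ (k + 1) :=
  homologyRestrictIso (translationToUnitInterval h1) k ≪≫
    (HomologicalComplex.homologyMapIso
      (inhomogeneousChainsIsoChainComplex Γ (SplitLine Γ)) k).symm ≪≫
    groupHomologyAugmentationIso (jumpsHom hΓ) (jumps_injective hΓ)
      (augmentation_eq_zero_iff hΓ) k

/-- The first homology of an abelian group with trivial integer coefficients. -/
noncomputable def integralGroupHomologyOneEquiv (Γ : AddSubgroup ℝ) :
    integralGroupHomology Γ 1 ≃+ Γ :=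
  (groupHomology.H1AddEquivOfIsTrivial (Rep.trivial ℤ (Multiplicative Γ) ℤ)).trans <|
    ((TensorProduct.rid ℤ (Additive (Abelianization (Multiplicative Γ)))).toAddEquiv).trans <|
    (MulEquiv.toAdditive (Abelianization.equivOfComm (H := Multiplicative Γ)).symm).trans
      (AddEquiv.additiveMultiplicative Γ)

end GroupoidHomology

theorem mainTheorem2 (Γ : AddSubgroup ℝ) (hΓ : Dense (Γ : Set ℝ)) (h1 : (1 : ℝ) ∈ Γ) :
    (∀ k : ℕ, Nonempty
      (TopologicalGroupoid.homology (intervalExchangeGroupoid_isEtale Γ h1) k ≅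
        integralGroupHomology Γ (k + 1))) ∧
    Nonempty (TopologicalGroupoid.homology (intervalExchangeGroupoid_isEtale Γ h1) 0 ≃+ Γ) :=
  ⟨fun k => ⟨homologyIntervalExchangeGroupoidIso Γ hΓ h1 k⟩,
    ⟨(homologyIntervalExchangeGroupoidIso Γ hΓ h1 0).toLinearEquiv.toAddEquiv.trans
      (integralGroupHomologyOneEquiv Γ)⟩⟩
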